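/- Let $x(t)$ be a continuous-time Markov chain on a finite set $E'$ with generator $\mathbf Q=\mathbf N(\mathbf P-\mathbf I)$, where $\mathbf N=\mathrm{diag}(\nu_k)$ with $\nu_k>0$ and $\mathbf P$ is an irreducible stochastic matrix; let $\pi$ be its stationary distribution. For each state $k$ let $\lambda_k>0$, $c_k>0$, and let $F_k$ be a probability distribution on $\mathbb R$ whose negative part is exponential: $F_k((-\infty,x])=F_k((-\infty,0))\,e^{c_kx}$ for $x<0$. Put $\boldsymbol\Psi(z)=\mathrm{diag}\Big(\lambda_k\int_{(0,\infty)}(e^{izy}-1)F_k(dy)+\lambda_kF_k((-\infty,0))\big(\tfrac{c_k}{c_k+iz}-1\big)\Big)+\mathbf Q$. Let $Z(t)=(\xi(t),x(t))$, started under $\mathrm P_i$ from $\xi(0)=0$, $x(0)=i$, be the right-continuous Markov process in which $\xi$ has stationary conditionally independent increments given $x$, with $\big\|\mathrm E[e^{i\alpha(\xi(s+t)-\xi(s))};\,x(s+t)=r\mid x(s)=k]\big\|_{k,r}=e^{t\boldsymbol\Psi(\alpha)}$ for all $s,t\ge0$ and $\alpha\in\mathbb R$ (so $\xi$ jumps at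 rate $\lambda_k$ with jump law $F_k$ while $x=k$, and does not jump at the transitions of $x$). Let $\psi_i(u)=\mathrm P_i\{\sup_{0\le t<\infty}\xi(t)>u\}$ and $m_1^0=\sum_k\pi_k\int_{\mathbb R}y\,\lambda_kF_k(dy)$. Let $\mathbf K(r)=\boldsymbol\Psi(-ir)$, and let $k(r)$ be its Perron root, i.e. its eigenvalue with the largest real part. Suppose that $m_1^0<0$, that $k(\gamma)=0$ for some $\gamma>0$ with $\int_{(0,\infty)}e^{\gamma y}F_k(dy)<\infty$ for all $k$, and that $\boldsymbol\nu$ and $\mathbf h$ are left and right eigenvectors of $\mathbf K(\gamma)$ for the eigenvalue $0$ with strictly positive entries and $\boldsymbol\nu\mathbf h=1$. With $\overline F_j(x)=F_j((x,\infty))$, put $$C_+=\max_{j}\frac1{h_j}\sup_{x\ge0}\frac{\overline F_j(x)}{\int_{(x,\infty)}e^{\gamma(y-x)}F_j(dy)},\qquad C_-=\min_{j}\frac1{h_j}\inf_{x\ge0}\frac{\overline F_j(x)}{\int_{(x,\infty)}e^{\gamma(y-x)}F_j(dy)},$$ where only the pairs $(j,x)$ with $\overline F_j(x)>0$ are taken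 into account. Then for all $i\in E'$ and all $u\ge0$ $$C_-h_ie^{-\gamma u}\le\psi_i(u)\le C_+h_ie^{-\gamma u}.$$ -/

import Mathlib

open MeasureTheory ProbabilityTheory Set
open scoped Matrix NNReal

noncomputable section

/-- The parameters of an almost lower semi-continuous process defined on a finite irreducible
Markov chain with set of states `E`, without jumps at the transition times of the chain. -/
structure ChainParams (E : Type*) [Fintype E] where
  /-- `nu k` is the rate of the (exponential) time spent by the chain in `k`. -/
  nu : E → ℝ
  /-- The transition matrix of the embedded chain. -/
  p : Matrix E E ℝ
  /-- `lam k` is the rate of the jumps of `ξ` while the chain is in `k`. -/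
  lam : E → ℝ
  /-- `c k` is the parameter of the exponential law of the negative jumps in state `k`. -/
  c : E → ℝ
  /-- `F k` is the law of the jumps of `ξ` in state `k`. -/
  F : E → Measure ℝ
  nu_pos : ∀ k, 0 < nu k
  p_irreducible : p.IsIrreducible
  p_row_sum : ∀ k, ∑ r, p k r = 1
  lam_pos : ∀ k, 0 < lam k
  c_pos : ∀ k, 0 < c k
  F_prob : ∀ k, IsProbabilityMeasure (F k)
  /-- Given that it is negative, a jump in state `k` is minus an exponential variable. -/
  F_neg : ∀ k, ∀ x < 0, (F k).real (Iic x) = (F k).real (Iio 0) * Real.exp (c k * x)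

namespace ChainParams

variable {E : Type*} [Fintype E] [DecidableEq E] (S : ChainParams E)

/-- The generator `Q = N (P - I)` of the chain. -/
def Q : Matrix E E ℝ := Matrix.diagonal S.nu * (S.p - 1)

/-- The matrix cumulant
`Ψ(z) = ∫₀^∞ (e^{i z y} - 1) Λ dF(y) + Λ F(0) (C (C + i z I)⁻¹ - I) + Q`,
where `F(0)` is the diagonal matrix of the probabilities of a negative jump. -/
def Psi (z : ℂ) : Matrix E E ℂ :=
  Matrix.diagonal (fun k =>
      (S.lam k : ℂ) * ∫ y in Ioi (0 : ℝ), (Complex.exp (Complex.I * z * (y : ℂ)) - 1) ∂(S.F k))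
    + Matrix.diagonal (fun k =>
      (S.lam k : ℂ) * ((S.F k).real (Iio 0) : ℂ)
        * ((S.c k : ℂ) / ((S.c k : ℂ) + Complex.I * z) - 1))
    + S.Q.map (fun a : ℝ => (a : ℂ))

/-- `K(r) = Ψ(-i r)`. -/
def K (r : ℝ) : Matrix E E ℂ := S.Psi (-(Complex.I * (r : ℂ)))

/-- The Perron root `k(r)` of `K(r)`: the largest real part of an eigenvalue. -/
def perronRoot (r : ℝ) : ℝ := sSup (Complex.re '' spectrum ℂ (S.K r))

/-- `pi` is a stationary distribution of the chain. -/
def IsStationary (pi : E → ℝ) : Prop :=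
  (∀ k, 0 ≤ pi k) ∧ ∑ k, pi k = 1 ∧ pi ᵥ* S.Q = 0

/-- The mean drift `m₁⁰ = ∑ₖ πₖ ∫ x λₖ Fₖ(dx)`. -/
def meanDrift (pi : E → ℝ) : ℝ := ∑ k, pi k * ∫ y, y * S.lam k ∂(S.F k)

/-- The values `(1 / h_j) P(X_j > x) / ∫_{(x,∞)} e^{γ (y - x)} F_j(dy)`, over all states `j` and
all `x ≥ 0` for which the quotient is meaningful, that is, `P(X_j > x) > 0` (`X_j` has law
`F_j`). -/
def lundbergRatios (g : ℝ) (h : E → ℝ) : Set ℝ :=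
  {v | ∃ (j : E) (x : ℝ), 0 ≤ x ∧ 0 < (S.F j).real (Ioi x) ∧
    v = 1 / h j * ((S.F j).real (Ioi x) / ∫ y in Ioi x, Real.exp (g * (y - x)) ∂(S.F j))}

/-- `C₊`, the maximum over `j` of the suprema over `x`. -/
def Cplus (g : ℝ) (h : E → ℝ) : ℝ := sSup (S.lundbergRatios g h)

/-- `C₋`, the minimum over `j` of the infima over `x`. -/
def Cminus (g : ℝ) (h : E → ℝ) : ℝ := sInf (S.lundbergRatios g h)

end ChainParams

/-- Under the probability measures `P i`, the process `Z(t) = (ξ(t), x(t))`, started from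
`(0, i)`, is a right-continuous Markov process with respect to `ℱ` in which `ξ` has stationary
conditionally independent increments given `x`, with matrix characteristic function
`‖E[e^{i α (ξ(s+t) - ξ(s))}; x(s+t) = r | x(s) = k]‖ = e^{t Ψ(α)}`. -/
structure IsMarkovAdditive {E Ω : Type*} [Fintype E] [DecidableEq E] {mΩ : MeasurableSpace Ω}
    (Psi : ℂ → Matrix E E ℂ) (P : E → Measure Ω) (ℱ : Filtration ℝ≥0 mΩ)
    (x : ℝ≥0 → Ω → E) (ξ : ℝ≥0 → Ω → ℝ) : Prop where
  prob : ∀ i, IsProbabilityMeasure (P i)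
  adapted_chain : ∀ t r, MeasurableSet[ℱ t] {ω | x t ω = r}
  adapted : ∀ t, Measurable[ℱ t] (ξ t)
  init : ∀ i, ∀ᵐ ω ∂(P i), x 0 ω = i ∧ ξ 0 ω = 0
  chain_right_cont : ∀ i, ∀ᵐ ω ∂(P i), ∀ t : ℝ≥0, ∀ᶠ s in nhdsWithin t (Ioi t), x s ω = x t ω
  right_cont : ∀ i, ∀ᵐ ω ∂(P i), ∀ t : ℝ≥0, ContinuousWithinAt (fun s => ξ s ω) (Ioi t) t
  markov : ∀ (i : E) (s t : ℝ≥0) (α : ℝ) (r : E),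
    (P i)[fun ω => {ω' | x (s + t) ω' = r}.indicator
        (fun ω' => Complex.exp (Complex.I * (α : ℂ) * ((ξ (s + t) ω' - ξ s ω' : ℝ) : ℂ))) ω | ℱ s]
      =ᵐ[P i] fun ω => NormedSpace.exp ((((t : ℝ) : ℂ)) • Psi (α : ℂ)) (x s ω) r

/-- The absolute maximum `ξ⁺ = sup_{0 ≤ t < ∞} ξ(t)`, possibly infinite. -/
def absMax {Ω : Type*} (ξ : ℝ≥0 → Ω → ℝ) (ω : Ω) : EReal := ⨆ t : ℝ≥0, (ξ t ω : EReal)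

/-- The ruin probability `ψ_i(u) = P_i(ξ⁺ > u)`. -/
def ruinProb {E Ω : Type*} {mΩ : MeasurableSpace Ω} (P : E → Measure Ω) (ξ : ℝ≥0 → Ω → ℝ)
    (i : E) (u : ℝ) : ℝ := (P i).real {ω | (u : EReal) < absMax ξ ω}

end

/-!
The process `(x, ξ)` has bounded jump rates, so its generator

`A f(k, y) = ∑ r, Q k r f(r, y) + λ_k ∫ (f(k, y + z) - f(k, y)) F_k(dz)`

(`ChainParams.gen`) is a bounded operator on bounded measurable functions. Uniformization of
`exp (t Ψ)` gives measures `transMeasure` with this matrix characteristic function, and uniqueness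
of characteristic functions turns the Markov property, stated through characteristic functions,
into the estimate `E[f(Z(s+t)); B] = E[(f + t A f)(Z(s)); B] + O(t²)` for every event `B` of the
past, uniformly in `s` and `B` (`IsMarkovAdditive.abs_setIntegral_sub_le`).

Consider the function equal to `C h_k e^{γ (y - u)}` for `y ≤ u` and to `1` for `y > u`. Since
`K(γ) h = 0`, its image under `A` at `y = u - x ≤ u` is
`λ_k (F̄_k(x) - C h_k ∫_{(x,∞)} e^{γ (z - x)} F_k(dz))` (`ChainParams.gen_expBelow`), which is `≤ 0`
for `C = C₊` and `≥ 0` for `C = C₋`. Hence on a time grid of mesh `δ`, stopping at the first grid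
time at which `ξ > u`, the expected value of this function is monotone up to an error `O(δ²)` per
step. At time `0` it is `C h_i e^{-γ u}`; later it is the probability of ruin on the grid plus
a nonnegative contribution of the surviving paths. For `C₊` this is the upper bound.

For `C₋` the contribution of survival must vanish in the limit. It is dominated by a function
`v_k e^{γ (y - u) / 2}`, killed above `u`, with `v > 0` and `K(γ/2) v < 0`: such a function decays
exponentially in mean. To find `v`, note that `K(γ/2) √h ≤ 0` by convexity, with strict inequality
in some state because not all jumps vanish (the drift is nonzero); irreducibility spreads the
strictness to all states (`ChainParams.exists_decay_vector`).

Finally the grid is refined dyadically, with horizon `m` and mesh `2⁻ᵐ`. The accumulated errors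
are of order `m 2⁻ᵐ`, and the ruin probabilities on the grids converge to `ruinProb` by right
continuity of `ξ`.
-/

/-! ### The matrix cumulant as a Lévy–Khintchine exponent -/

namespace ChainParams

variable {E : Type*} [Fintype E] (S : ChainParams E)

instance (k : E) : IsProbabilityMeasure (S.F k) := S.F_prob k

/-- A jump law restricted to the negative half-line is a multiple of an exponential law. -/
lemma F_restrict_Iio (k : E) :
    (S.F k).restrict (Iio 0) = (S.F k) (Iio 0) •
      (volume.restrict (Iio (0 : ℝ))).withDensity
        (fun y => ENNReal.ofReal (S.c k * Real.exp (S.c k * y))) := by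
  have hc := S.c_pos k
  apply Measure.ext_of_Iic
  intro a
  have key : ∀ b : ℝ, ∫⁻ y in Iio b, ENNReal.ofReal (S.c k * Real.exp (S.c k * y))
      = ENNReal.ofReal (Real.exp (S.c k * b)) := by
    intro b
    rw [Measure.restrict_congr_set Iio_ae_eq_Iic, ← ofReal_integral_eq_lintegral_ofReal,
      integral_const_mul, integral_exp_mul_Iic hc]
    · field_simp
    · exact (integrableOn_exp_mul_Iic hc b).const_mul _
    · filter_upwards with y
      positivity
  rw [Measure.restrict_apply measurableSet_Iic, Measure.smul_apply,
    withDensity_apply _ measurableSet_Iic, Measure.restrict_restrict measurableSet_Iic, smul_eq_mul]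
  rcases lt_or_ge a 0 with ha | ha
  · have h1 : Iic a ∩ Iio 0 = Iic a := by
      ext y; simp only [mem_inter_iff, mem_Iic, mem_Iio]; grind
    rw [h1, Measure.restrict_congr_set Iio_ae_eq_Iic.symm, key]
    have := S.F_neg k a ha
    rw [← ofReal_measureReal (μ := S.F k) (s := Iic a), this,
      ENNReal.ofReal_mul (by positivity), ofReal_measureReal]
  · have h1 : Iic a ∩ Iio 0 = Iio 0 := by
      ext y; simp only [mem_inter_iff, mem_Iic, mem_Iio]; grind
    rw [h1, key]
    simp

lemma integral_cexp_Iio (k : E) {z : ℂ} (hz : 0 ≤ z.re) :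
    ∫ y in Iio (0 : ℝ), Complex.exp (z * (y : ℂ)) ∂(S.F k)
      = ((S.F k).real (Iio 0) : ℂ) * ((S.c k : ℂ) / ((S.c k : ℂ) + z)) := by
  have hc := S.c_pos k
  have hre : 0 < ((S.c k : ℂ) + z).re := by
    simp only [Complex.add_re, Complex.ofReal_re]; linarith
  rw [F_restrict_Iio, integral_smul_measure,
    integral_withDensity_eq_integral_toReal_smul (by fun_prop) (by simp)]
  have : ∀ y : ℝ, (ENNReal.ofReal (S.c k * Real.exp (S.c k * y))).toReal • Complex.exp (z * (y : ℂ))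
      = (S.c k : ℂ) * Complex.exp (((S.c k : ℂ) + z) * (y : ℂ)) := by
    intro y
    rw [ENNReal.toReal_ofReal (by positivity), Complex.real_smul, add_mul, Complex.exp_add]
    push_cast
    ring
  simp only [this]
  rw [integral_const_mul, Measure.restrict_congr_set Iio_ae_eq_Iic,
    integral_exp_mul_complex_Iic hre]
  simp [Measure.real, div_eq_mul_inv]

lemma integrable_cexp (k : E) {z : ℂ} (hz : 0 ≤ z.re)
    (hint : IntegrableOn (fun y => Real.exp (z.re * y)) (Ioi 0) (S.F k)) :
    Integrable (fun y : ℝ => Complex.exp (z * (y : ℂ))) (S.F k) := by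
  rw [← integrableOn_univ, ← Iic_union_Ioi (a := (0 : ℝ))]
  refine IntegrableOn.union ?_ ?_
  · refine Measure.integrableOn_of_bounded (M := 1) (by simp) (by fun_prop) ?_
    refine ae_restrict_of_forall_mem measurableSet_Iic fun y hy => ?_
    rw [Complex.norm_exp]
    simpa using mul_nonpos_of_nonneg_of_nonpos hz hy
  · refine hint.mono' (by fun_prop) ?_
    filter_upwards with y
    simp [Complex.norm_exp]

lemma integrable_exp (k : E) {θ : ℝ} (hθ : 0 ≤ θ)
    (hint : IntegrableOn (fun y => Real.exp (θ * y)) (Ioi 0) (S.F k)) :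
    Integrable (fun y : ℝ => Real.exp (θ * y)) (S.F k) := by
  have := (S.integrable_cexp k (z := θ) (by simpa using hθ) (by simpa using hint)).norm
  simpa [Complex.norm_exp] using this

/-- The integral over all jumps of size `≠ 0`, split by sign, has the explicit form that enters
`Psi`. -/
lemma integral_cexp_sub_one (k : E) {z : ℂ} (hz : 0 ≤ z.re)
    (hint : IntegrableOn (fun y => Real.exp (z.re * y)) (Ioi 0) (S.F k)) :
    ∫ y, (Complex.exp (z * (y : ℂ)) - 1) ∂(S.F k)
      = (∫ y in Ioi (0 : ℝ), (Complex.exp (z * (y : ℂ)) - 1) ∂(S.F k))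
        + ((S.F k).real (Iio 0) : ℂ) * ((S.c k : ℂ) / ((S.c k : ℂ) + z) - 1) := by
  have hI : Integrable (fun y : ℝ => Complex.exp (z * (y : ℂ)) - 1) (S.F k) :=
    (S.integrable_cexp k hz hint).sub (integrable_const _)
  have h0 : ∫ y in Ici (0 : ℝ), (Complex.exp (z * (y : ℂ)) - 1) ∂(S.F k)
      = ∫ y in Ioi (0 : ℝ), (Complex.exp (z * (y : ℂ)) - 1) ∂(S.F k) := by
    refine setIntegral_eq_of_subset_of_forall_sdiff_eq_zero measurableSet_Ici Ioi_subset_Ici_self ?_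
    rintro y ⟨hy, hy'⟩
    have : y = 0 := le_antisymm (not_lt.mp hy') hy
    simp [this]
  have hneg : ∫ y in Iio (0 : ℝ), (Complex.exp (z * (y : ℂ)) - 1) ∂(S.F k)
      = ((S.F k).real (Iio 0) : ℂ) * ((S.c k : ℂ) / ((S.c k : ℂ) + z) - 1) := by
    rw [integral_sub (S.integrable_cexp k hz hint).integrableOn (integrable_const _),
      S.integral_cexp_Iio k hz]
    simp [mul_sub]
  rw [← integral_add_compl measurableSet_Iio hI, compl_Iio, h0, hneg, add_comm]

variable [DecidableEq E]

/-- The matrix cumulant is the Lévy–Khintchine exponent of a compound Poisson process in each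
state, plus the generator of the chain. -/
lemma Psi_apply {w : ℂ} (hw : 0 ≤ (Complex.I * w).re)
    (hint : ∀ k, IntegrableOn (fun y => Real.exp ((Complex.I * w).re * y)) (Ioi 0) (S.F k))
    (k r : E) :
    S.Psi w k r = (if k = r then (S.lam k : ℂ) *
      ∫ y, (Complex.exp (Complex.I * w * (y : ℂ)) - 1) ∂(S.F k) else 0) + (S.Q k r : ℂ) := by
  simp only [Psi, Matrix.add_apply, Matrix.diagonal_apply, Matrix.map_apply]
  split_ifs with h
  · rw [S.integral_cexp_sub_one k hw (hint k)]
    ring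
  · simp

/-- The real form of `K(γ) h = 0`. -/
lemma real_eigen {γ : ℝ} (hγ : 0 < γ)
    (hint : ∀ k, IntegrableOn (fun y => Real.exp (γ * y)) (Ioi 0) (S.F k)) {h : E → ℝ}
    (hh : S.K γ *ᵥ (fun k => (h k : ℂ)) = 0) (k : E) :
    S.lam k * (∫ y, (Real.exp (γ * y) - 1) ∂(S.F k)) * h k + ∑ r, S.Q k r * h r = 0 := by
  have hz : Complex.I * -(Complex.I * (γ : ℂ)) = γ := by
    rw [mul_neg, ← mul_assoc, Complex.I_mul_I]; ring
  have h1 := congrFun hh k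
  simp only [Matrix.mulVec, dotProduct, K, Pi.zero_apply] at h1
  rw [Finset.sum_congr rfl fun r _ => by
    rw [S.Psi_apply (by rw [hz]; simpa using hγ.le) (by rw [hz]; simpa using hint) k r, hz]] at h1
  have h2 : ∫ y : ℝ, (Complex.exp ((γ : ℂ) * (y : ℂ)) - 1) ∂(S.F k)
      = ((∫ y, (Real.exp (γ * y) - 1) ∂(S.F k) : ℝ) : ℂ) := by
    rw [← integral_complex_ofReal]
    push_cast
    rfl
  simp only [h2, add_mul, Finset.sum_add_distrib, ite_mul, zero_mul, Finset.sum_ite_eq,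
    Finset.mem_univ, if_true] at h1
  exact_mod_cast h1

lemma Q_apply (k r : E) : S.Q k r = S.nu k * (S.p k r - if k = r then 1 else 0) := by
  simp [Q, Matrix.diagonal_mul, Matrix.sub_apply, Matrix.one_apply]

lemma Q_row_sum (k : E) : ∑ r, S.Q k r = 0 := by
  simp [Q_apply, ← Finset.mul_sum, S.p_row_sum]

lemma Q_nonneg {k r : E} (h : k ≠ r) : 0 ≤ S.Q k r := by
  rw [Q_apply, if_neg h, sub_zero]
  exact mul_nonneg (S.nu_pos k).le (S.p_irreducible.nonneg k r)

lemma neg_nu_le_Q (k : E) : -S.nu k ≤ S.Q k k := by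
  rw [Q_apply, if_pos rfl]
  nlinarith [mul_nonneg (S.nu_pos k).le (S.p_irreducible.nonneg k k)]

end ChainParams

/-! ### Uniformization -/

lemma charFun_finset_sum {ι : Type*} (s : Finset ι) (μ : ι → Measure ℝ)
    [∀ i, IsFiniteMeasure (μ i)] (α : ℝ) :
    charFun (∑ i ∈ s, μ i) α = ∑ i ∈ s, charFun (μ i) α := by
  simp only [charFun_apply_real]
  refine integral_finsetSum_measure fun i _ => ?_
  refine Integrable.of_bound (by fun_prop) 1 (Filter.Eventually.of_forall fun y => ?_)
  rw [← Complex.ofReal_mul, Complex.norm_exp_ofReal_mul_I]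

/-- If `|a n| ≤ b ^ n`, the Poisson average of `a n / b ^ n` agrees with its first-order
expansion in `t` up to a quadratic error. -/
lemma abs_poisson_sub_le {a : ℕ → ℝ} {b t s : ℝ} (hb : 0 ≤ b) (ht : 0 ≤ t)
    (ha : ∀ n, |a n| ≤ b ^ n)
    (hs : HasSum (fun n => Real.exp (-(b * t)) * (t ^ n / n.factorial) * a n) s) :
    |s - (a 0 + t * (a 1 - b * a 0))| ≤ 3 * (b * t) ^ 2 := by
  set x := b * t with hx
  have hx0 : 0 ≤ x := mul_nonneg hb ht
  set e := Real.exp (-x) with he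
  have he1 : e ≤ 1 := Real.exp_le_one_iff.mpr (by linarith)
  have he2 : 1 - x ≤ e := by linarith [Real.add_one_le_exp (-x)]
  have he3 : e - 1 + x ≤ x ^ 2 := by
    have h1 : e * (1 + x) ≤ 1 := by
      have h2 := Real.add_one_le_exp x
      have h3 : e * Real.exp x = 1 := by rw [he, ← Real.exp_add]; simp
      nlinarith [Real.exp_pos (-x)]
    nlinarith
  have hb' : HasSum (fun n : ℕ => e * (t ^ n / n.factorial) * b ^ n) 1 := by
    have h := (NormedSpace.expSeries_div_hasSum_exp x).mul_left e
    rw [← Real.exp_eq_exp_ℝ, he, ← Real.exp_add, neg_add_cancel, Real.exp_zero] at h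
    refine Eq.mpr (congrArg (HasSum · _) (funext fun n => ?_)) h
    rw [hx, mul_pow]
    ring
  have h1 : HasSum (fun n : ℕ => e * (t ^ (n + 2) / (n + 2).factorial) * b ^ (n + 2))
      (1 - e * (1 + x)) := by
    rw [hasSum_nat_add_iff (f := fun n : ℕ => e * (t ^ n / n.factorial) * b ^ n)]
    have h : 1 - e * (1 + x) + ∑ n ∈ Finset.range 2, e * (t ^ n / n.factorial) * b ^ n = 1 := by
      simp [Finset.sum_range_succ, hx]
      ring
    rwa [h]
  have h2 : HasSum (fun n : ℕ => e * (t ^ (n + 2) / (n + 2).factorial) * a (n + 2))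
      (s - e * (a 0 + t * a 1)) := by
    rw [hasSum_nat_add_iff (f := fun n : ℕ => e * (t ^ n / n.factorial) * a n)]
    have h : s - e * (a 0 + t * a 1) + ∑ n ∈ Finset.range 2, e * (t ^ n / n.factorial) * a n
        = s := by
      simp [Finset.sum_range_succ]
      ring
    rwa [h]
  have h3 : |s - e * (a 0 + t * a 1)| ≤ 1 - e * (1 + x) := by
    rw [← h2.tsum_eq, ← h1.tsum_eq, ← Real.norm_eq_abs]
    refine tsum_of_norm_bounded h1.summable.hasSum fun n => ?_
    rw [Real.norm_eq_abs, abs_mul, abs_of_nonneg (by positivity)]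
    exact mul_le_mul_of_nonneg_left (ha _) (by positivity)
  have ha0 : |a 0| ≤ 1 := by simpa using ha 0
  have ha1 : |t * a 1| ≤ x := by
    rw [abs_mul, abs_of_nonneg ht, hx, mul_comm]
    exact mul_le_mul_of_nonneg_right (by simpa using ha 1) ht
  have h4 : |(e - 1 + x) * a 0| ≤ x ^ 2 := by
    rw [abs_mul, abs_of_nonneg (by linarith)]
    calc (e - 1 + x) * |a 0| ≤ x ^ 2 * 1 := by gcongr
      _ = x ^ 2 := mul_one _
  have h5 : |(e - 1) * (t * a 1)| ≤ x ^ 2 := by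
    rw [abs_mul, abs_of_nonpos (by linarith), sq]
    gcongr
    linarith
  have h6 : 1 - e * (1 + x) ≤ x ^ 2 := by nlinarith
  have : s - (a 0 + t * (a 1 - b * a 0))
      = (s - e * (a 0 + t * a 1)) + (e - 1 + x) * a 0 + (e - 1) * (t * a 1) := by
    rw [hx]; ring
  rw [this]
  refine (abs_add_three _ _ _).trans ?_
  linarith

namespace ChainParams

variable {E : Type*} [Fintype E] [DecidableEq E] (S : ChainParams E)

/-- A common bound for the total transition rates out of all states. -/
noncomputable def rate : ℝ := ∑ k, (S.lam k + S.nu k)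

omit [DecidableEq E] in
lemma lam_add_nu_le_rate (k : E) : S.lam k + S.nu k ≤ S.rate :=
  Finset.single_le_sum (f := fun k => S.lam k + S.nu k)
    (fun j _ => (add_pos (S.lam_pos j) (S.nu_pos j)).le) (Finset.mem_univ k)

omit [DecidableEq E] in
lemma rate_nonneg : 0 ≤ S.rate :=
  Finset.sum_nonneg fun j _ => (add_pos (S.lam_pos j) (S.nu_pos j)).le

/-- Weight of the zero displacement in the uniformized chain. -/
noncomputable def stayWeight (k r : E) : ℝ := (if k = r then S.rate - S.lam k else 0) + S.Q k r

lemma stayWeight_nonneg (k r : E) : 0 ≤ S.stayWeight k r := by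
  unfold stayWeight
  split_ifs with h
  · subst h
    linarith [S.lam_add_nu_le_rate k, S.neg_nu_le_Q k]
  · simpa using S.Q_nonneg h

/-- One step of the uniformized chain: the measure of displacements of `ξ` along a transition
`k → r`. Each row has total mass `rate`, not `1`. -/
noncomputable def stepMeasure (k r : E) : Measure ℝ :=
  ENNReal.ofReal (S.stayWeight k r) • Measure.dirac 0
    + if k = r then ENNReal.ofReal (S.lam k) • S.F k else 0

instance (k r : E) : IsFiniteMeasure (S.stepMeasure k r) := by
  have h0 := (Measure.dirac (0 : ℝ)).smul_finite (ENNReal.ofReal_ne_top (r := S.stayWeight k r))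
  have h1 := (S.F k).smul_finite (ENNReal.ofReal_ne_top (r := S.lam k))
  unfold stepMeasure
  split_ifs <;> infer_instance

lemma integral_stepMeasure {V : Type*} [NormedAddCommGroup V] [NormedSpace ℝ V] [CompleteSpace V]
    {k r : E} {f : ℝ → V} (hf : Integrable f (S.F k)) :
    ∫ y, f y ∂(S.stepMeasure k r)
      = S.stayWeight k r • f 0 + if k = r then S.lam k • ∫ y, f y ∂(S.F k) else 0 := by
  have h0 : Integrable f (ENNReal.ofReal (S.stayWeight k r) • Measure.dirac (0 : ℝ)) :=
    (integrable_dirac (by simp)).smul_measure (by simp)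
  unfold stepMeasure
  split_ifs with h
  · rw [integral_add_measure h0 (hf.smul_measure (by simp)), integral_smul_measure,
      integral_smul_measure, integral_dirac, ENNReal.toReal_ofReal (S.stayWeight_nonneg k r),
      ENNReal.toReal_ofReal (S.lam_pos k).le]
  · rw [add_zero, integral_smul_measure, integral_dirac,
      ENNReal.toReal_ofReal (S.stayWeight_nonneg k r), add_zero]

/-- Convolution powers of the matrix of measures `stepMeasure`. -/
noncomputable def stepPow : ℕ → E → E → Measure ℝ
  | 0, k, r => if k = r then Measure.dirac 0 else 0
  | n + 1, k, r => ∑ j, (S.stepMeasure k j).conv (stepPow n j r)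

instance (n : ℕ) (k r : E) : IsFiniteMeasure (S.stepPow n k r) := by
  induction n generalizing k with
  | zero => unfold stepPow; split_ifs <;> infer_instance
  | succ n ih => unfold stepPow; infer_instance

/-- The transform of the step measures is `rate • 1 + Psi`. -/
lemma charFun_stepMeasure (k r : E) (α : ℝ) :
    charFun (S.stepMeasure k r) α = (((S.rate : ℂ) • (1 : Matrix E E ℂ)) + S.Psi α) k r := by
  have hre : (Complex.I * (α : ℂ)).re = 0 := by simp
  have hI : Integrable (fun y : ℝ => Complex.exp (α * y * Complex.I)) (S.F k) := by
    refine Integrable.of_bound (by fun_prop) 1 (Filter.Eventually.of_forall fun y => ?_)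
    rw [← Complex.ofReal_mul, Complex.norm_exp_ofReal_mul_I]
  have hcomm : ∀ y : ℝ, Complex.exp (Complex.I * α * y) = Complex.exp (α * y * Complex.I) := by
    intro y; ring_nf
  rw [charFun_apply_real, S.integral_stepMeasure hI, Matrix.add_apply,
    S.Psi_apply hre.ge (by intro j; rw [hre]; simp), Matrix.smul_apply, Matrix.one_apply]
  simp only [hcomm]
  rw [integral_sub hI (integrable_const _)]
  unfold stayWeight
  split_ifs with h
  · simp
    ring
  · simp

lemma charFun_stepPow (n : ℕ) (k r : E) (α : ℝ) :
    charFun (S.stepPow n k r) α = ((((S.rate : ℂ) • (1 : Matrix E E ℂ)) + S.Psi α) ^ n) k r := by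
  induction n generalizing k with
  | zero =>
    simp only [stepPow, pow_zero, Matrix.one_apply]
    split_ifs <;> simp
  | succ n ih =>
    rw [stepPow, charFun_finset_sum, pow_succ', Matrix.mul_apply]
    exact Finset.sum_congr rfl fun j _ => by rw [charFun_conv, ih, S.charFun_stepMeasure]

lemma sum_stepMeasure_univ (k : E) : ∑ r, (S.stepMeasure k r).real univ = S.rate := by
  have h : ∀ r, (S.stepMeasure k r).real univ
      = S.stayWeight k r + if k = r then S.lam k else 0 := by
    intro r
    have := S.integral_stepMeasure (k := k) (r := r) (f := fun _ => (1 : ℝ)) (integrable_const _)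
    simpa using this
  simp [h, stayWeight, Finset.sum_add_distrib, S.Q_row_sum]

lemma sum_stepPow_univ (n : ℕ) (k : E) : ∑ r, (S.stepPow n k r).real univ = S.rate ^ n := by
  induction n generalizing k with
  | zero =>
    have h : ∀ r, (S.stepPow 0 k r).real univ = if k = r then 1 else 0 := by
      intro r
      simp only [stepPow]
      split_ifs <;> simp
    simp [h]
  | succ n ih =>
    have h : ∀ r, (S.stepPow (n + 1) k r).real univ
        = ∑ j, (S.stepMeasure k j).real univ * (S.stepPow n j r).real univ := by
      intro r
      rw [stepPow, measureReal_def, Measure.finsetSum_apply, ENNReal.toReal_sum (by simp)]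
      refine Finset.sum_congr rfl fun j _ => ?_
      rw [Measure.conv, Measure.map_apply (by fun_prop) MeasurableSet.univ, preimage_univ,
        ← univ_prod_univ, Measure.prod_prod, ENNReal.toReal_mul]
      rfl
    simp only [h]
    rw [Finset.sum_comm]
    simp only [← Finset.mul_sum, ih]
    rw [← Finset.sum_mul, S.sum_stepMeasure_univ, pow_succ']

/-- Weights of the (non-normalized) powers in the uniformization formula. -/
noncomputable def poissonWeight (t : ℝ) (n : ℕ) : ℝ :=
  Real.exp (-(S.rate * t)) * (t ^ n / n.factorial)

omit [DecidableEq E] in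
lemma poissonWeight_nonneg {t : ℝ} (ht : 0 ≤ t) (n : ℕ) : 0 ≤ S.poissonWeight t n := by
  unfold poissonWeight; positivity

omit [DecidableEq E] in
lemma hasSum_poissonWeight (t : ℝ) : HasSum (fun n => S.poissonWeight t n * S.rate ^ n) 1 := by
  have h := (NormedSpace.expSeries_div_hasSum_exp (S.rate * t)).mul_left (Real.exp (-(S.rate * t)))
  rw [← Real.exp_eq_exp_ℝ, ← Real.exp_add, neg_add_cancel, Real.exp_zero] at h
  refine Eq.mpr (congrArg (HasSum · _) (funext fun n => ?_)) h
  unfold poissonWeight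
  rw [mul_pow]
  ring

/-- The law of the displacement of `ξ` during time `t`, on the event that the chain moves from
`k` to `r`, obtained by uniformization. -/
noncomputable def transMeasure (t : ℝ) (k r : E) : Measure ℝ :=
  Measure.sum fun n => ENNReal.ofReal (S.poissonWeight t n) • S.stepPow n k r

lemma isFiniteMeasure_transMeasure {t : ℝ} (ht : 0 ≤ t) (k r : E) :
    IsFiniteMeasure (S.transMeasure t k r) := by
  refine ⟨?_⟩
  rw [transMeasure, Measure.sum_apply _ MeasurableSet.univ]
  have hle : ∀ n, (ENNReal.ofReal (S.poissonWeight t n) • S.stepPow n k r) univ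
      ≤ ENNReal.ofReal (S.poissonWeight t n * S.rate ^ n) := by
    intro n
    rw [Measure.smul_apply, smul_eq_mul, ENNReal.ofReal_mul (S.poissonWeight_nonneg ht n),
      ← ofReal_measureReal]
    gcongr
    rw [← S.sum_stepPow_univ n k]
    exact Finset.single_le_sum (f := fun r => (S.stepPow n k r).real univ)
      (fun _ _ => measureReal_nonneg) (Finset.mem_univ r)
  refine (ENNReal.tsum_le_tsum hle).trans_lt ?_
  rw [← ENNReal.ofReal_tsum_of_nonneg
    (fun n => mul_nonneg (S.poissonWeight_nonneg ht n) (pow_nonneg S.rate_nonneg n))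
    (S.hasSum_poissonWeight t).summable]
  exact ENNReal.ofReal_lt_top

lemma hasSum_integral_transMeasure {V : Type*} [NormedAddCommGroup V] [NormedSpace ℝ V]
    {t : ℝ} (ht : 0 ≤ t) (k r : E) {f : ℝ → V}
    (hf : Integrable f (S.transMeasure t k r)) :
    HasSum (fun n => S.poissonWeight t n • ∫ y, f y ∂(S.stepPow n k r))
      (∫ y, f y ∂(S.transMeasure t k r)) := by
  have := hasSum_integral_measure hf
  simp only [integral_smul_measure, ENNReal.toReal_ofReal (S.poissonWeight_nonneg ht _)] at this
  exact this

open scoped Matrix.Norms.Operator in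
lemma hasSum_exp_smul_Psi (t α : ℝ) (k r : E) :
    HasSum (fun n => (S.poissonWeight t n : ℂ) *
      ((((S.rate : ℂ) • (1 : Matrix E E ℂ)) + S.Psi α) ^ n) k r)
      (NormedSpace.exp ((t : ℂ) • S.Psi α) k r) := by
  set A : Matrix E E ℂ := ((S.rate : ℂ) • (1 : Matrix E E ℂ)) + S.Psi α with hA
  have h1 : (t : ℂ) • S.Psi α = (t : ℂ) • A + (-(S.rate * t : ℂ)) • (1 : Matrix E E ℂ) := by
    rw [hA, smul_add, smul_smul, neg_smul, mul_comm (t : ℂ)]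
    abel
  have h2 : NormedSpace.exp ((t : ℂ) • S.Psi α)
      = Complex.exp (-(S.rate * t : ℂ)) • NormedSpace.exp ((t : ℂ) • A) := by
    rw [h1, Matrix.exp_add_of_commute _ _ ((Commute.one_right _).smul_right _),
      ← Matrix.diagonal_one, ← Matrix.diagonal_smul, Matrix.exp_diagonal]
    ext a b
    simp [Matrix.mul_diagonal, Pi.exp_def, ← Complex.exp_eq_exp_ℂ, mul_comm]
  have h3 := NormedSpace.exp_series_hasSum_exp' (𝕂 := ℂ) ((t : ℂ) • A)
  have h4 := (Pi.hasSum.mp (Pi.hasSum.mp h3 k) r).mul_left (Complex.exp (-(S.rate * t : ℂ)))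
  rw [h2, Matrix.smul_apply, smul_eq_mul]
  refine Eq.mpr (congrArg (HasSum · _) (funext fun n => ?_)) h4
  simp only [poissonWeight, smul_pow, Matrix.smul_apply, smul_eq_mul]
  push_cast
  ring

/-- The transition measures have the prescribed matrix characteristic function. -/
lemma charFun_transMeasure {t : ℝ} (ht : 0 ≤ t) (k r : E) (α : ℝ) :
    charFun (S.transMeasure t k r) α = NormedSpace.exp ((t : ℂ) • S.Psi α) k r := by
  have := S.isFiniteMeasure_transMeasure ht k r
  have hI : Integrable (fun y : ℝ => Complex.exp (α * y * Complex.I)) (S.transMeasure t k r) := by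
    refine Integrable.of_bound (by fun_prop) 1 (Filter.Eventually.of_forall fun y => ?_)
    rw [← Complex.ofReal_mul, Complex.norm_exp_ofReal_mul_I]
  have h := S.hasSum_integral_transMeasure ht k r hI
  simp only [← charFun_apply_real, charFun_stepPow, Complex.real_smul] at h
  exact h.unique (S.hasSum_exp_smul_Psi t α k r)

/-- The generator of the process `(x, ξ)` on bounded functions. -/
noncomputable def gen (f : E → ℝ → ℝ) (k : E) (y : ℝ) : ℝ :=
  ∑ r, S.Q k r * f r y + S.lam k * ∫ z, (f k (y + z) - f k y) ∂(S.F k)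

/-- The transition operators of the process `(x, ξ)`. -/
noncomputable def trans (t : ℝ) (f : E → ℝ → ℝ) (k : E) (y : ℝ) : ℝ :=
  ∑ r, ∫ z, f r (y + z) ∂(S.transMeasure t k r)

/-- The semigroup generated by the bounded operator `gen`, to first order and uniformly in the
starting point. -/
lemma abs_trans_sub_le {t : ℝ} (ht : 0 ≤ t) {f : E → ℝ → ℝ} (hf : ∀ k, Measurable (f k))
    (hf1 : ∀ k y, |f k y| ≤ 1) (k : E) (y : ℝ) :
    |S.trans t f k y - (f k y + t * S.gen f k y)| ≤ 3 * (S.rate * t) ^ 2 := by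
  have hint : ∀ (r : E) (μ : Measure ℝ) [IsFiniteMeasure μ], Integrable (fun z => f r (y + z)) μ :=
    fun r μ _ => Integrable.of_bound ((hf r).comp (measurable_const_add y)).aestronglyMeasurable 1
      (Filter.Eventually.of_forall fun z => hf1 r _)
  let a : ℕ → ℝ := fun n => ∑ r, ∫ z, f r (y + z) ∂(S.stepPow n k r)
  have ha : ∀ n, |a n| ≤ S.rate ^ n := by
    intro n
    rw [← S.sum_stepPow_univ n k]
    refine (Finset.abs_sum_le_sum_abs _ _).trans (Finset.sum_le_sum fun r _ => ?_)
    have := norm_integral_le_of_norm_le_const (μ := S.stepPow n k r)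
      (f := fun z => f r (y + z)) (C := 1)
      (Filter.Eventually.of_forall fun z => hf1 r (y + z))
    simpa using this
  have hs : HasSum (fun n => S.poissonWeight t n * a n) (S.trans t f k y) := by
    simp only [a, Finset.mul_sum]
    refine hasSum_sum fun r _ => ?_
    have := S.isFiniteMeasure_transMeasure ht k r
    exact S.hasSum_integral_transMeasure ht k r (hint r _)
  have ha0 : a 0 = f k y := by
    simp only [a, stepPow]
    rw [Finset.sum_eq_single k]
    · simp
    · intro r _ hr
      simp [hr.symm]
    · simp
  have ha1 : a 1 = S.rate * f k y + S.gen f k y := by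
    have hstep : ∀ r, S.stepPow 1 k r = S.stepMeasure k r := by
      intro r
      simp only [stepPow]
      rw [Finset.sum_eq_single r]
      · simp
      · intro j _ hj
        simp [hj]
      · simp
    simp only [a, hstep]
    rw [Finset.sum_congr rfl fun r _ => by
      rw [show ∫ z, f r (y + z) ∂(S.stepMeasure k r) = _ from S.integral_stepMeasure (hint r _)]]
    simp only [gen, stayWeight, add_zero, smul_eq_mul, add_mul, Finset.sum_add_distrib, ite_mul,
      zero_mul, Finset.sum_ite_eq, Finset.mem_univ, if_true]
    rw [integral_sub (hint k _) (integrable_const _)]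
    simp
    ring
  have := abs_poisson_sub_le S.rate_nonneg ht ha hs
  rwa [ha0, ha1, add_sub_cancel_left] at this

lemma measurable_trans (t : ℝ) (ht : 0 ≤ t) {f : E → ℝ → ℝ} (hf : ∀ k, Measurable (f k)) (k : E) :
    Measurable (S.trans t f k) := by
  refine Finset.measurable_fun_sum _ fun r _ => ?_
  have := S.isFiniteMeasure_transMeasure ht k r
  have hm : Measurable fun p : ℝ × ℝ => f r (p.1 + p.2) := (hf r).comp (by fun_prop)
  exact hm.stronglyMeasurable.integral_prod_right'.measurable

lemma measurable_gen {f : E → ℝ → ℝ} (hf : ∀ k, Measurable (f k)) (k : E) :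
    Measurable (S.gen f k) := by
  refine (Finset.measurable_fun_sum _ fun r _ => (hf r).const_mul _).add (Measurable.const_mul ?_ _)
  have hm : Measurable fun p : ℝ × ℝ => f k (p.1 + p.2) - f k p.1 :=
    ((hf k).comp (by fun_prop)).sub ((hf k).comp (by fun_prop))
  exact hm.stronglyMeasurable.integral_prod_right'.measurable

lemma abs_gen_le {f : E → ℝ → ℝ} {M : ℝ} (hf1 : ∀ k y, |f k y| ≤ M) (k : E) (y : ℝ) :
    |S.gen f k y| ≤ ∑ r, |S.Q k r| * M + S.lam k * (M + M) := by
  refine (abs_add_le _ _).trans (add_le_add ((Finset.abs_sum_le_sum_abs _ _).trans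
    (Finset.sum_le_sum fun r _ => ?_)) ?_)
  · rw [abs_mul]
    exact mul_le_mul_of_nonneg_left (hf1 r y) (abs_nonneg _)
  · rw [abs_mul, abs_of_pos (S.lam_pos k)]
    refine mul_le_mul_of_nonneg_left ?_ (S.lam_pos k).le
    have := norm_integral_le_of_norm_le_const (μ := S.F k) (C := M + M)
      (f := fun z => f k (y + z) - f k y) (Filter.Eventually.of_forall fun z =>
        (norm_sub_le _ _).trans (add_le_add (hf1 k (y + z)) (hf1 k y)))
    simpa using this

lemma gen_const_mul (f : E → ℝ → ℝ) (a : ℝ) (k : E) (y : ℝ) :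
    S.gen (fun r z => a * f r z) k y = a * S.gen f k y := by
  simp only [gen, ← mul_sub, integral_const_mul, mul_add, Finset.mul_sum]
  congr 1
  · exact Finset.sum_congr rfl fun r _ => by ring
  · ring

end ChainParams

/-! ### The Markov property for bounded functions -/

lemma measurable_select {E Ω : Type*} [Finite E] {mΩ : MeasurableSpace Ω} {x : Ω → E}
    (hx : ∀ r, MeasurableSet {ω | x ω = r}) {g : E → Ω → ℝ} (hg : ∀ r, Measurable (g r)) :
    Measurable fun ω => g (x ω) ω := by
  intro T hT
  have : (fun ω => g (x ω) ω) ⁻¹' T = ⋃ r, {ω | x ω = r} ∩ g r ⁻¹' T := by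
    ext ω; simp
  rw [this]
  exact MeasurableSet.iUnion fun r => (hx r).inter (hg r hT)

lemma setIntegral_select {E Ω : Type*} [Fintype E] {mΩ : MeasurableSpace Ω}
    {μ : Measure Ω} {x : Ω → E} (hx : ∀ r, MeasurableSet {ω | x ω = r}) {g : E → Ω → ℝ}
    (hg : ∀ r, Integrable (g r) μ) (B : Set Ω) :
    ∫ ω in B, g (x ω) ω ∂μ = ∑ r, ∫ ω in B ∩ {ω | x ω = r}, g r ω ∂μ := by
  classical
  have h : ∀ ω, g (x ω) ω = ∑ r, {ω | x ω = r}.indicator (g r) ω := by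
    intro ω
    rw [Finset.sum_eq_single (x ω)]
    · simp
    · intro r _ hr
      simp [hr.symm]
    · simp
  simp only [h]
  rw [integral_finsetSum _ fun r _ => ((hg r).indicator (hx r)).integrableOn]
  exact Finset.sum_congr rfl fun r _ => setIntegral_indicator (hx r)

lemma integrable_select {E Ω : Type*} [Finite E] {mΩ : MeasurableSpace Ω}
    {μ : Measure Ω} {x : Ω → E} (hx : ∀ r, MeasurableSet {ω | x ω = r}) {g : E → Ω → ℝ}
    (hg : ∀ r, Integrable (g r) μ) : Integrable (fun ω => g (x ω) ω) μ := by
  classical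
  have := Fintype.ofFinite E
  refine (integrable_finsetSum Finset.univ fun r _ => (hg r).indicator (hx r)).congr
    (Filter.Eventually.of_forall fun ω => ?_)
  simp only
  rw [Finset.sum_eq_single (x ω)]
  · simp
  · intro r _ hr
    simp [hr.symm]
  · simp

namespace IsMarkovAdditive

variable {E Ω : Type*} [Fintype E] [DecidableEq E] {mΩ : MeasurableSpace Ω} {S : ChainParams E}
  {P : E → Measure Ω} {ℱ : Filtration ℝ≥0 mΩ} {x : ℝ≥0 → Ω → E} {ξ : ℝ≥0 → Ω → ℝ}

lemma measurableSet_chain (hZ : IsMarkovAdditive S.Psi P ℱ x ξ) (t : ℝ≥0) (r : E) :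
    MeasurableSet {ω | x t ω = r} :=
  ℱ.le t _ (hZ.adapted_chain t r)

lemma measurable (hZ : IsMarkovAdditive S.Psi P ℱ x ξ) (t : ℝ≥0) : Measurable (ξ t) :=
  (hZ.adapted t).mono (ℱ.le t) le_rfl

/-- On an event of the past contained in `x s = k`, the increment of `ξ` together with the new
state of the chain is governed by the transition measures: both sides have the same
characteristic function. -/
lemma map_increment (hZ : IsMarkovAdditive S.Psi P ℱ x ξ) (i : E) (s t : ℝ≥0) {k : E} (r : E)
    {B : Set Ω} (hB : MeasurableSet[ℱ s] B) (hBk : B ⊆ {ω | x s ω = k}) :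
    ((P i).restrict (B ∩ {ω | x (s + t) ω = r})).map (fun ω => ξ (s + t) ω - ξ s ω)
      = P i B • S.transMeasure t k r := by
  have := hZ.prob i
  have hfin := S.isFiniteMeasure_transMeasure t.coe_nonneg k r
  have hfin' := (S.transMeasure t k r).smul_finite (measure_ne_top (P i) B)
  have hΔ : Measurable fun ω => ξ (s + t) ω - ξ s ω :=
    (hZ.measurable _).sub (hZ.measurable _)
  have hr := hZ.measurableSet_chain (s + t) r
  apply Measure.ext_of_charFun
  ext α
  have hsmul : charFun (P i B • S.transMeasure t k r) α
      = (P i).real B • charFun (S.transMeasure t k r) α := by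
    simp only [charFun_apply_real, integral_smul_measure, measureReal_def]
  rw [hsmul, S.charFun_transMeasure t.coe_nonneg, charFun_apply_real,
    integral_map hΔ.aemeasurable (by fun_prop)]
  have hint : Integrable (fun ω => {ω' | x (s + t) ω' = r}.indicator
      (fun ω' => Complex.exp (Complex.I * (α : ℂ) * ((ξ (s + t) ω' - ξ s ω' : ℝ) : ℂ))) ω) (P i) := by
    refine Integrable.indicator (Integrable.of_bound ?_ 1 ?_) hr
    · exact (Complex.measurable_exp.comp
        ((Complex.measurable_ofReal.comp hΔ).const_mul _)).aestronglyMeasurable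
    · refine Filter.Eventually.of_forall fun ω => ?_
      rw [mul_assoc, ← Complex.ofReal_mul, Complex.norm_exp_I_mul_ofReal]
  have h1 := setIntegral_condExp (ℱ.le s) hint hB
  rw [setIntegral_indicator hr, setIntegral_congr_ae (ℱ.le s _ hB)
    (g := fun _ => NormedSpace.exp ((((t : ℝ) : ℂ)) • S.Psi (α : ℂ)) k r)
    ((hZ.markov i s t α r).mono fun ω hω hωB => by
      have hk : x s ω = k := hBk hωB
      rw [hω]
      simp only [hk]), setIntegral_const] at h1
  rw [h1]
  refine integral_congr_ae (Filter.Eventually.of_forall fun ω => ?_)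
  simp only
  ring_nf

/-- Given `x s = k`, the increment of `ξ` and the new state of the chain are independent of
`ξ s` and of the past event `B`. -/
lemma map_prod (hZ : IsMarkovAdditive S.Psi P ℱ x ξ) (i : E) (s t : ℝ≥0) (k r : E)
    {B : Set Ω} (hB : MeasurableSet[ℱ s] B) :
    ((P i).restrict (B ∩ {ω | x s ω = k} ∩ {ω | x (s + t) ω = r})).map
        (fun ω => (ξ s ω, ξ (s + t) ω - ξ s ω))
      = (((P i).restrict (B ∩ {ω | x s ω = k})).map (ξ s)).prod (S.transMeasure t k r) := by
  have := hZ.prob i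
  have hfin := S.isFiniteMeasure_transMeasure t.coe_nonneg k r
  have hΔ : Measurable fun ω => ξ (s + t) ω - ξ s ω :=
    (hZ.measurable _).sub (hZ.measurable _)
  symm
  apply Measure.prod_eq
  intro U V hU hV
  have hB' : MeasurableSet[ℱ s] (ξ s ⁻¹' U ∩ (B ∩ {ω | x s ω = k})) :=
    (hZ.adapted s hU).inter (hB.inter (hZ.adapted_chain s k))
  have h := congrArg (fun μ => μ V) (hZ.map_increment i s t r hB' fun ω hω => hω.2.2)
  simp only [Measure.smul_apply, smul_eq_mul] at h
  rw [Measure.map_apply hΔ hV, Measure.restrict_apply (hΔ hV)] at h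
  rw [Measure.map_apply ((hZ.measurable s).prodMk hΔ) (hU.prod hV),
    Measure.restrict_apply (((hZ.measurable s).prodMk hΔ) (hU.prod hV)),
    Measure.map_apply (hZ.measurable s) hU, Measure.restrict_apply (hZ.measurable s hU), ← h]
  congr 1
  ext ω
  simp only [mem_inter_iff, mem_preimage, mem_prod, mem_ofPred_eq]
  tauto

/-- The Markov property, for a bounded function of the state `(x, ξ)`. -/
lemma setIntegral_eq_trans (hZ : IsMarkovAdditive S.Psi P ℱ x ξ) (i : E) (s t : ℝ≥0)
    {B : Set Ω} (hB : MeasurableSet[ℱ s] B) {f : E → ℝ → ℝ} (hf : ∀ k, Measurable (f k))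
    (hf1 : ∀ k y, |f k y| ≤ 1) :
    ∫ ω in B, f (x (s + t) ω) (ξ (s + t) ω) ∂(P i)
      = ∑ k, ∫ ω in B ∩ {ω | x s ω = k}, S.trans t f k (ξ s ω) ∂(P i) := by
  have := hZ.prob i
  have hΔ : Measurable fun ω => ξ (s + t) ω - ξ s ω :=
    (hZ.measurable _).sub (hZ.measurable _)
  have hsum := setIntegral_select (μ := P i) (g := fun r ω => f r (ξ (s + t) ω))
    (hZ.measurableSet_chain (s + t)) (fun r => Integrable.of_bound
      ((hf r).comp (hZ.measurable _)).aestronglyMeasurable 1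
      (Filter.Eventually.of_forall fun ω => hf1 r _))
  have hsplit := setIntegral_select (μ := P i) (x := x s)
    (g := fun _ ω => f (x (s + t) ω) (ξ (s + t) ω))
    (hZ.measurableSet_chain s) (fun r => Integrable.of_bound
      (measurable_select (g := fun r ω => f r (ξ (s + t) ω)) (hZ.measurableSet_chain (s + t))
        fun r => (hf r).comp (hZ.measurable _)).aestronglyMeasurable 1
      (Filter.Eventually.of_forall fun ω => hf1 _ _)) B
  rw [hsplit]
  refine Finset.sum_congr rfl fun k _ => ?_
  rw [hsum]
  have hk : ∀ r, ∫ ω in B ∩ {ω | x s ω = k} ∩ {ω | x (s + t) ω = r}, f r (ξ (s + t) ω) ∂(P i)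
      = ∫ ω in B ∩ {ω | x s ω = k}, ∫ z, f r (ξ s ω + z) ∂(S.transMeasure t k r) ∂(P i) := by
    intro r
    have hfin := S.isFiniteMeasure_transMeasure t.coe_nonneg k r
    have hm : Measurable fun p : ℝ × ℝ => f r (p.1 + p.2) := (hf r).comp (by fun_prop)
    have h1 := integral_map (μ := (P i).restrict (B ∩ {ω | x s ω = k} ∩ {ω | x (s + t) ω = r}))
      ((hZ.measurable s).prodMk hΔ).aemeasurable (f := fun p : ℝ × ℝ => f r (p.1 + p.2))
      hm.aestronglyMeasurable
    simp only [add_sub_cancel] at h1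
    rw [← h1, hZ.map_prod i s t k r hB, integral_prod _ (Integrable.of_bound
      hm.aestronglyMeasurable 1 (Filter.Eventually.of_forall fun p => hf1 r _)),
      integral_map (hZ.measurable s).aemeasurable]
    exact hm.stronglyMeasurable.integral_prod_right'.aestronglyMeasurable
  simp only [hk]
  rw [← integral_finsetSum]
  · rfl
  · intro r _
    have hfin := S.isFiniteMeasure_transMeasure t.coe_nonneg k r
    have hm : Measurable fun p : ℝ × ℝ => f r (p.1 + p.2) := (hf r).comp (by fun_prop)
    refine Integrable.of_bound (hm.stronglyMeasurable.integral_prod_right'.comp_measurable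
      (hZ.measurable s)).aestronglyMeasurable ((S.transMeasure t k r).real univ)
      (Filter.Eventually.of_forall fun ω => ?_)
    have := norm_integral_le_of_norm_le_const (μ := S.transMeasure t k r) (C := 1)
      (f := fun z => f r (ξ s ω + z)) (Filter.Eventually.of_forall fun z => hf1 r _)
    simpa using this

lemma integrable_state (hZ : IsMarkovAdditive S.Psi P ℱ x ξ) (i : E) (s : ℝ≥0)
    {f : E → ℝ → ℝ} (hf : ∀ k, Measurable (f k)) {M : E → ℝ} (hfM : ∀ k y, |f k y| ≤ M k) :
    Integrable (fun ω => f (x s ω) (ξ s ω)) (P i) := by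
  have := hZ.prob i
  exact integrable_select (g := fun k ω => f k (ξ s ω)) (hZ.measurableSet_chain s) fun k =>
    Integrable.of_bound ((hf k).comp (hZ.measurable _)).aestronglyMeasurable (M k)
      (Filter.Eventually.of_forall fun ω => hfM k _)

/-- Uniformly in the past event `B`, over a short time the mean of a bounded
function of the state on `B` evolves according to the generator, up to an error of second order. -/
lemma abs_setIntegral_sub_le_of_le_one (hZ : IsMarkovAdditive S.Psi P ℱ x ξ) (i : E) (s t : ℝ≥0)
    {B : Set Ω} (hB : MeasurableSet[ℱ s] B) {f : E → ℝ → ℝ} (hf : ∀ k, Measurable (f k))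
    (hf1 : ∀ k y, |f k y| ≤ 1) :
    |∫ ω in B, f (x (s + t) ω) (ξ (s + t) ω) ∂(P i)
      - ∫ ω in B, (f (x s ω) (ξ s ω) + t * S.gen f (x s ω) (ξ s ω)) ∂(P i)|
      ≤ 3 * (S.rate * t) ^ 2 := by
  have := hZ.prob i
  have hbd := fun k (y : ℝ) => S.abs_trans_sub_le t.coe_nonneg hf hf1 k y
  have hgen : ∀ k, Integrable (fun ω => f k (ξ s ω) + t * S.gen f k (ξ s ω)) (P i) := by
    intro k
    refine Integrable.add (Integrable.of_bound
      ((hf k).comp (hZ.measurable _)).aestronglyMeasurable 1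
      (Filter.Eventually.of_forall fun ω => hf1 k _)) (Integrable.const_mul (Integrable.of_bound
      ((S.measurable_gen hf k).comp (hZ.measurable _)).aestronglyMeasurable _
      (Filter.Eventually.of_forall fun ω => S.abs_gen_le hf1 k _)) _)
  have hdiff : ∀ k, Integrable (fun ω => S.trans t f k (ξ s ω)
      - (f k (ξ s ω) + t * S.gen f k (ξ s ω))) (P i) := by
    intro k
    refine Integrable.of_bound (Measurable.aestronglyMeasurable ?_) _
      (Filter.Eventually.of_forall fun ω => hbd k _)
    exact ((S.measurable_trans t t.coe_nonneg hf k).comp (hZ.measurable _)).sub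
      (((hf k).comp (hZ.measurable _)).add
        (((S.measurable_gen hf k).comp (hZ.measurable _)).const_mul _))
  have htrans : ∀ k, Integrable (fun ω => S.trans t f k (ξ s ω)) (P i) := by
    intro k
    exact ((hdiff k).add (hgen k)).congr (Filter.Eventually.of_forall fun ω => by simp)
  rw [hZ.setIntegral_eq_trans i s t hB hf hf1,
    setIntegral_select (μ := P i) (g := fun k ω => f k (ξ s ω) + t * S.gen f k (ξ s ω))
      (hZ.measurableSet_chain s) hgen B, ← Finset.sum_sub_distrib,
    Finset.sum_congr rfl fun k _ =>
      (integral_sub (htrans k).integrableOn (hgen k).integrableOn).symm,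
    ← setIntegral_select (μ := P i)
      (g := fun k ω => S.trans t f k (ξ s ω) - (f k (ξ s ω) + t * S.gen f k (ξ s ω)))
      (hZ.measurableSet_chain s) hdiff B]
  refine (norm_setIntegral_le_of_norm_le_const (C := 3 * (S.rate * t) ^ 2)
    (f := fun ω => S.trans t f (x s ω) (ξ s ω)
      - (f (x s ω) (ξ s ω) + t * S.gen f (x s ω) (ξ s ω))) (measure_lt_top _ _)
    (fun ω _ => hbd (x s ω) (ξ s ω))).trans ?_
  exact mul_le_of_le_one_right (by positivity) measureReal_le_one

/-- Version of the previous estimate for functions bounded by `M`, by scaling. -/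
lemma abs_setIntegral_sub_le (hZ : IsMarkovAdditive S.Psi P ℱ x ξ) (i : E) (s t : ℝ≥0)
    {B : Set Ω} (hB : MeasurableSet[ℱ s] B) {f : E → ℝ → ℝ} (hf : ∀ k, Measurable (f k))
    {M : ℝ} (hM : 0 < M) (hfM : ∀ k y, |f k y| ≤ M) :
    |∫ ω in B, f (x (s + t) ω) (ξ (s + t) ω) ∂(P i)
      - (∫ ω in B, f (x s ω) (ξ s ω) ∂(P i) + t * ∫ ω in B, S.gen f (x s ω) (ξ s ω) ∂(P i))|
      ≤ M * (3 * (S.rate * t) ^ 2) := by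
  have h := hZ.abs_setIntegral_sub_le_of_le_one i s t hB (f := fun k y => M⁻¹ * f k y)
    (fun k => (hf k).const_mul _) (fun k y => by
      rw [abs_mul, abs_of_pos (inv_pos.mpr hM)]
      exact inv_mul_le_one_of_le₀ (hfM k y) hM.le)
  have h1 : ∀ ω, M⁻¹ * f (x s ω) (ξ s ω)
      + t * S.gen (fun k y => M⁻¹ * f k y) (x s ω) (ξ s ω)
      = M⁻¹ * (f (x s ω) (ξ s ω) + t * S.gen f (x s ω) (ξ s ω)) := by
    intro ω
    rw [S.gen_const_mul]
    ring
  simp only [h1, integral_const_mul] at h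
  rw [integral_add (hZ.integrable_state i s hf hfM).integrableOn
    ((hZ.integrable_state i s (S.measurable_gen hf) (S.abs_gen_le hfM)).const_mul _).integrableOn,
    integral_const_mul, ← mul_sub, abs_mul, abs_of_pos (inv_pos.mpr hM)] at h
  rwa [inv_mul_le_iff₀ hM] at h

end IsMarkovAdditive

/-! ### The process on a grid, stopped above a level -/

/-- The event that `ξ` does not exceed `u` at any of the first `n + 1` points of the grid of
mesh `δ`. -/
def noRuin {Ω : Type*} (ξ : ℝ≥0 → Ω → ℝ) (u : ℝ) (δ : ℝ≥0) (n : ℕ) : Set Ω :=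
  {ω | ∀ j ≤ n, ξ (j * δ) ω ≤ u}

lemma noRuin_succ {Ω : Type*} (ξ : ℝ≥0 → Ω → ℝ) (u : ℝ) (δ : ℝ≥0) (n : ℕ) :
    noRuin ξ u δ (n + 1) = noRuin ξ u δ n ∩ {ω | ξ (n * δ + δ) ω ≤ u} := by
  ext ω
  have h : ((n + 1 : ℕ) : ℝ≥0) * δ = n * δ + δ := by push_cast; ring
  simp only [noRuin, mem_inter_iff, mem_ofPred_eq]
  refine ⟨fun H => ⟨fun j hj => H j (by omega), by rw [← h]; exact H _ le_rfl⟩, ?_⟩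
  rintro ⟨H1, H2⟩ j hj
  rcases Nat.le_succ_iff.mp hj with hj | rfl
  · exact H1 j hj
  · rwa [Nat.succ_eq_add_one, h]

namespace IsMarkovAdditive

variable {E Ω : Type*} [Fintype E] [DecidableEq E] {mΩ : MeasurableSpace Ω} {S : ChainParams E}
  {P : E → Measure Ω} {ℱ : Filtration ℝ≥0 mΩ} {x : ℝ≥0 → Ω → E} {ξ : ℝ≥0 → Ω → ℝ}

lemma measurableSet_noRuin (hZ : IsMarkovAdditive S.Psi P ℱ x ξ) (u : ℝ) (δ : ℝ≥0) (n : ℕ) :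
    MeasurableSet[ℱ (n * δ)] (noRuin ξ u δ n) := by
  have : noRuin ξ u δ n = ⋂ j ∈ Finset.range (n + 1), {ω | ξ (j * δ) ω ≤ u} := by
    ext ω; simp [noRuin]
  rw [this]
  refine Finset.measurableSet_biInter _ fun j hj => ?_
  have hj' : (j : ℝ≥0) * δ ≤ n * δ := by
    gcongr
    exact Finset.mem_range_succ_iff.mp hj
  exact ℱ.mono hj' _ (hZ.adapted (j * δ) measurableSet_Iic)

/-- The expected value of `f` for the grid process stopped when it first exceeds `u`, where `f`
takes the value `a` above `u`. -/
noncomputable def stoppedValue (P : E → Measure Ω) (x : ℝ≥0 → Ω → E) (ξ : ℝ≥0 → Ω → ℝ)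
    (f : E → ℝ → ℝ) (a u : ℝ) (δ : ℝ≥0) (i : E) (n : ℕ) : ℝ :=
  ∫ ω in noRuin ξ u δ n, f (x (n * δ) ω) (ξ (n * δ) ω) ∂(P i) + a * (P i).real (noRuin ξ u δ n)ᶜ

/-- The discrete Dynkin formula for the grid process stopped above `u`. -/
lemma abs_stoppedValue_succ_sub_le (hZ : IsMarkovAdditive S.Psi P ℱ x ξ)
    {f : E → ℝ → ℝ} (hf : ∀ k, Measurable (f k)) {M : ℝ} (hM : 0 < M)
    (hfM : ∀ k y, |f k y| ≤ M) {a u : ℝ} (hfa : ∀ k y, u < y → f k y = a) (δ : ℝ≥0) (i : E)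
    (n : ℕ) :
    |stoppedValue P x ξ f a u δ i (n + 1) - (stoppedValue P x ξ f a u δ i n
      + δ * ∫ ω in noRuin ξ u δ n, S.gen f (x (n * δ) ω) (ξ (n * δ) ω) ∂(P i))|
      ≤ M * (3 * (S.rate * δ) ^ 2) := by
  have := hZ.prob i
  have hn : ((n + 1 : ℕ) : ℝ≥0) * δ = n * δ + δ := by push_cast; ring
  have hB := hZ.measurableSet_noRuin u δ n
  have hB0 := ℱ.le _ _ hB
  have hB1 := ℱ.le _ _ (hZ.measurableSet_noRuin u δ (n + 1))
  have hsub : noRuin ξ u δ (n + 1) ⊆ noRuin ξ u δ n := by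
    rw [noRuin_succ]; exact inter_subset_left
  have key := hZ.abs_setIntegral_sub_le i (n * δ) δ hB hf hM hfM
  have hint := hZ.integrable_state i (n * δ + δ) hf hfM
  have hsplit : ∫ ω in noRuin ξ u δ n, f (x (n * δ + δ) ω) (ξ (n * δ + δ) ω) ∂(P i)
      = ∫ ω in noRuin ξ u δ (n + 1), f (x (n * δ + δ) ω) (ξ (n * δ + δ) ω) ∂(P i)
        + a * ((P i).real (noRuin ξ u δ (n + 1))ᶜ - (P i).real (noRuin ξ u δ n)ᶜ) := by
    rw [← union_sdiff_cancel hsub, setIntegral_union disjoint_sdiff_right (hB0.diff hB1)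
      hint.integrableOn hint.integrableOn, union_sdiff_cancel hsub]
    congr 1
    rw [setIntegral_congr_fun (g := fun _ => a) (hB0.diff hB1), setIntegral_const,
      measureReal_sdiff hsub hB1, probReal_compl_eq_one_sub hB0, probReal_compl_eq_one_sub hB1,
      smul_eq_mul]
    · ring
    · intro ω hω
      refine hfa _ _ (not_le.mp fun h => hω.2 ?_)
      rw [noRuin_succ]
      exact ⟨hω.1, h⟩
  rw [hsplit] at key
  unfold stoppedValue
  rw [hn]
  convert key using 2
  ring

lemma stoppedValue_zero (hZ : IsMarkovAdditive S.Psi P ℱ x ξ)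
    (f : E → ℝ → ℝ) (a : ℝ) {u : ℝ} (hu : 0 ≤ u) (δ : ℝ≥0) (i : E) :
    stoppedValue P x ξ f a u δ i 0 = f i 0 := by
  have := hZ.prob i
  have h1 : noRuin ξ u δ 0 =ᵐ[P i] univ := by
    refine Filter.eventuallyEq_univ.mpr ?_
    filter_upwards [hZ.init i] with ω hω
    intro j hj
    rw [Nat.le_zero.mp hj]
    simpa [hω.2] using hu
  have h2 : (P i).real (noRuin ξ u δ 0)ᶜ = 0 := by
    rw [measureReal_congr h1.compl]
    simp
  unfold stoppedValue
  rw [h2, setIntegral_congr_set h1, setIntegral_univ,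
    integral_congr_ae (g := fun _ => f i 0)]
  · simp
  · filter_upwards [hZ.init i] with ω hω
    simp [hω.1, hω.2]

lemma stoppedValue_le (hZ : IsMarkovAdditive S.Psi P ℱ x ξ)
    {f : E → ℝ → ℝ} (hf : ∀ k, Measurable (f k)) {M : ℝ} (hM : 0 < M)
    (hfM : ∀ k y, |f k y| ≤ M) {a u : ℝ} (hu : 0 ≤ u) (hfa : ∀ k y, u < y → f k y = a)
    (hgen : ∀ k y, y ≤ u → S.gen f k y ≤ 0) (δ : ℝ≥0) (i : E) (n : ℕ) :
    stoppedValue P x ξ f a u δ i n ≤ f i 0 + n * (M * (3 * (S.rate * δ) ^ 2)) := by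
  induction n with
  | zero => simp [hZ.stoppedValue_zero f a hu]
  | succ n ih =>
    have h1 := (abs_le.mp (hZ.abs_stoppedValue_succ_sub_le hf hM hfM hfa δ i n)).2
    have h2 : ∫ ω in noRuin ξ u δ n, S.gen f (x (n * δ) ω) (ξ (n * δ) ω) ∂(P i) ≤ 0 :=
      setIntegral_nonpos (ℱ.le _ _ (hZ.measurableSet_noRuin u δ n))
        fun ω hω => hgen _ _ (hω n le_rfl)
    have h3 := mul_nonpos_of_nonneg_of_nonpos δ.coe_nonneg h2
    push_cast
    linarith

lemma le_stoppedValue (hZ : IsMarkovAdditive S.Psi P ℱ x ξ)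
    {f : E → ℝ → ℝ} (hf : ∀ k, Measurable (f k)) {M : ℝ} (hM : 0 < M)
    (hfM : ∀ k y, |f k y| ≤ M) {a u : ℝ} (hu : 0 ≤ u) (hfa : ∀ k y, u < y → f k y = a)
    (hgen : ∀ k y, y ≤ u → 0 ≤ S.gen f k y) (δ : ℝ≥0) (i : E) (n : ℕ) :
    f i 0 - n * (M * (3 * (S.rate * δ) ^ 2)) ≤ stoppedValue P x ξ f a u δ i n := by
  induction n with
  | zero => simp [hZ.stoppedValue_zero f a hu]
  | succ n ih =>
    have h1 := (abs_le.mp (hZ.abs_stoppedValue_succ_sub_le hf hM hfM hfa δ i n)).1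
    have h2 : 0 ≤ ∫ ω in noRuin ξ u δ n, S.gen f (x (n * δ) ω) (ξ (n * δ) ω) ∂(P i) :=
      setIntegral_nonneg (ℱ.le _ _ (hZ.measurableSet_noRuin u δ n))
        fun ω hω => hgen _ _ (hω n le_rfl)
    have h3 := mul_nonneg δ.coe_nonneg h2
    push_cast
    linarith

/-- If `f` vanishes above `u` and the generator contracts it at rate `ε` below `u`, its expected
value on survival decays exponentially. -/
lemma stoppedValue_le_exp (hZ : IsMarkovAdditive S.Psi P ℱ x ξ)
    {f : E → ℝ → ℝ} (hf : ∀ k, Measurable (f k)) {M : ℝ} (hM : 0 < M)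
    (hfM : ∀ k y, |f k y| ≤ M) {u : ℝ} (hu : 0 ≤ u) (hfa : ∀ k y, u < y → f k y = 0)
    {ε : ℝ} (hε : 0 < ε) (hgen : ∀ k y, y ≤ u → S.gen f k y ≤ -(ε * f k y)) {δ : ℝ≥0}
    (hεδ : ε * δ ≤ 1) (i : E) (n : ℕ) :
    stoppedValue P x ξ f 0 u δ i n
      ≤ M * Real.exp (-(ε * (n * δ))) + M * (3 * S.rate ^ 2 * δ) / ε := by
  suffices h : stoppedValue P x ξ f 0 u δ i n
      ≤ M * (1 - ε * δ) ^ n + M * (3 * S.rate ^ 2 * δ) / ε by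
    refine h.trans ?_
    gcongr
    calc (1 - ε * δ) ^ n ≤ Real.exp (-(ε * δ)) ^ n :=
          pow_le_pow_left₀ (by linarith) (Real.one_sub_le_exp_neg _) n
      _ = Real.exp (-(ε * (n * δ))) := by
          rw [← Real.exp_nat_mul]
          ring_nf
  induction n with
  | zero =>
    rw [hZ.stoppedValue_zero f 0 hu, pow_zero, mul_one]
    have h1 := (le_abs_self _).trans (hfM i 0)
    have h2 : 0 ≤ M * (3 * S.rate ^ 2 * δ) / ε := by positivity
    linarith
  | succ n ih =>
    have h1 := (abs_le.mp (hZ.abs_stoppedValue_succ_sub_le hf hM hfM hfa δ i n)).2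
    have h2 : ∫ ω in noRuin ξ u δ n, S.gen f (x (n * δ) ω) (ξ (n * δ) ω) ∂(P i)
        ≤ -(ε * stoppedValue P x ξ f 0 u δ i n) := by
      unfold stoppedValue
      rw [zero_mul, add_zero, ← integral_const_mul, ← integral_neg]
      exact setIntegral_mono_on
        (hZ.integrable_state i _ (S.measurable_gen hf) (S.abs_gen_le hfM)).integrableOn
        ((hZ.integrable_state i _ hf hfM).const_mul _).neg.integrableOn
        (ℱ.le _ _ (hZ.measurableSet_noRuin u δ n)) fun ω hω => hgen _ _ (hω n le_rfl)
    have h3 := mul_le_mul_of_nonneg_left h2 δ.coe_nonneg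
    have h4 := mul_le_mul_of_nonneg_left ih (sub_nonneg.mpr hεδ)
    have h5 : (1 - ε * δ) * (M * (1 - ε * δ) ^ n + M * (3 * S.rate ^ 2 * δ) / ε)
        + M * (3 * (S.rate * δ) ^ 2)
        = M * (1 - ε * δ) ^ (n + 1) + M * (3 * S.rate ^ 2 * δ) / ε := by
      field_simp
      ring
    linarith

end IsMarkovAdditive

/-! ### Irreducible nonnegative matrices and exponential test functions -/

namespace Matrix

variable {E : Type*} [Fintype E] [DecidableEq E]

lemma pow_apply_pos_of_pos_imp {A B : Matrix E E ℝ} (hA : ∀ i j, 0 ≤ A i j)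
    (hB : ∀ i j, 0 ≤ B i j) (h : ∀ i j, 0 < A i j → 0 < B i j) (n : ℕ) (i j : E)
    (hij : 0 < (A ^ n) i j) : 0 < (B ^ n) i j := by
  induction n generalizing j with
  | zero => simpa using hij
  | succ n ih =>
    rw [pow_succ, mul_apply] at hij ⊢
    obtain ⟨l, -, hl⟩ := Finset.exists_lt_of_sum_lt (f := fun _ => (0 : ℝ))
      (by simpa using hij : ∑ l : E, (0 : ℝ) < ∑ l, (A ^ n) i l * A l j)
    have h1 : 0 < (A ^ n) i l :=
      (pow_apply_nonneg hA n i l).lt_of_ne fun h0 => by simp [← h0] at hl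
    have h2 : 0 < A l j := (hA l j).lt_of_ne fun h0 => by simp [← h0] at hl
    exact Finset.sum_pos' (fun l _ => mul_nonneg (pow_apply_nonneg hB n i l) (hB l j))
      ⟨l, Finset.mem_univ l, mul_pos (ih l h1) (h l j h2)⟩

/-- A nonnegative matrix with a positive superinvariant vector `w` that is not invariant at some
`k₀` reachable from everywhere has a positive strictly superinvariant vector. -/
lemma exists_mulVec_lt {T : Matrix E E ℝ} (hT : ∀ i j, 0 ≤ T i j) {w : E → ℝ}
    (hw : ∀ k, 0 < w k) (hTw : ∀ k, (T *ᵥ w) k ≤ w k) {k₀ : E} (hk₀ : (T *ᵥ w) k₀ < w k₀)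
    (hreach : ∀ i, ∃ m : ℕ, 0 < (T ^ m) i k₀) :
    ∃ v : E → ℝ, (∀ k, 0 < v k) ∧ ∀ k, (T *ᵥ v) k < v k := by
  choose m hm using hreach
  -- The sum of the iterates of `w` telescopes to the accumulated defect of `w`.
  let N := ∑ i, m i + 1
  let v : E → ℝ := ∑ n ∈ Finset.range N, T ^ n *ᵥ w
  have hpow : ∀ n i j, 0 ≤ (T ^ n) i j := pow_apply_nonneg hT
  have hpos : ∀ n k, 0 ≤ (T ^ n *ᵥ w) k := fun n k =>
    Finset.sum_nonneg fun j _ => mul_nonneg (hpow n k j) (hw j).le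
  have hdef : v - T *ᵥ v = ∑ n ∈ Finset.range N, T ^ n *ᵥ (w - T *ᵥ w) := by
    simp only [v, mulVec_sum, ← Finset.sum_sub_distrib, mulVec_sub, mulVec_mulVec, ← pow_succ,
      ← pow_succ']
  refine ⟨v, fun k => ?_, fun k => ?_⟩
  · simp only [v, Finset.sum_apply]
    exact Finset.sum_pos' (fun n _ => hpos n k) ⟨0, by simp [N], by simpa using hw k⟩
  · rw [← sub_pos]
    have h1 := congrFun hdef k
    simp only [Pi.sub_apply, Finset.sum_apply] at h1
    rw [h1]
    have hd : ∀ j, 0 ≤ (w - T *ᵥ w) j := fun j => sub_nonneg.mpr (hTw j)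
    refine Finset.sum_pos'
      (fun n _ => Finset.sum_nonneg fun j _ => mul_nonneg (hpow n k j) (hd j)) ⟨m k, ?_, ?_⟩
    · exact Finset.mem_range.mpr (Nat.lt_succ_of_le
        (Finset.single_le_sum (fun _ _ => Nat.zero_le _) (Finset.mem_univ k)))
    · exact Finset.sum_pos' (fun j _ => mul_nonneg (hpow _ k j) (hd j))
        ⟨k₀, Finset.mem_univ _, mul_pos (hm k) (sub_pos.mpr hk₀)⟩

end Matrix

namespace ChainParams

variable {E : Type*} [Fintype E] [DecidableEq E] (S : ChainParams E)

omit [DecidableEq E] in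
/-- A nonzero drift excludes that all jumps vanish. -/
lemma exists_integral_sq_pos {pi : E → ℝ} (hm : S.meanDrift pi < 0) {θ : ℝ} (hθ : 0 < θ)
    (hint : ∀ k, Integrable (fun z => (Real.exp (θ * z) - 1) ^ 2) (S.F k)) :
    ∃ k, 0 < ∫ z, (Real.exp (θ * z) - 1) ^ 2 ∂(S.F k) := by
  by_contra! H
  have h0 : ∀ k, ∫ y, y * S.lam k ∂(S.F k) = 0 := by
    intro k
    have h1 : ∫ z, (Real.exp (θ * z) - 1) ^ 2 ∂(S.F k) = 0 :=
      le_antisymm (H k) (integral_nonneg fun z => sq_nonneg _)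
    rw [integral_eq_zero_iff_of_nonneg (fun z => sq_nonneg _) (hint k)] at h1
    refine integral_eq_zero_of_ae ?_
    filter_upwards [h1] with z hz
    have hz' : Real.exp (θ * z) = 1 := by
      have := pow_eq_zero_iff two_ne_zero |>.mp hz
      linarith
    have hz0 : z = 0 := by
      rcases mul_eq_zero.mp (Real.exp_eq_one_iff _ |>.mp hz') with h | h
      · exact absurd h hθ.ne'
      · exact h
    simp [hz0]
  simp [meanDrift, h0] at hm

/-- Convexity of the cumulant between `0` and `γ`: the square root of the eigenvector at `γ`
yields a strictly subinvariant vector at `γ / 2`. -/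
lemma exists_decay_vector {pi : E → ℝ} (hm : S.meanDrift pi < 0) {γ : ℝ} (hγ : 0 < γ)
    (hint : ∀ k, Integrable (fun y => Real.exp (γ * y)) (S.F k))
    (hint2 : ∀ k, Integrable (fun y => Real.exp (γ / 2 * y)) (S.F k))
    {h : E → ℝ} (hh_pos : ∀ k, 0 < h k)
    (hh : ∀ k, S.lam k * (∫ y, (Real.exp (γ * y) - 1) ∂(S.F k)) * h k + ∑ r, S.Q k r * h r = 0) :
    ∃ v : E → ℝ, (∀ k, 0 < v k) ∧ ∀ k,
      S.lam k * (∫ y, (Real.exp (γ / 2 * y) - 1) ∂(S.F k)) * v k + ∑ r, S.Q k r * v r < 0 := by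
  let J : E → ℝ := fun k => ∫ y, (Real.exp (γ / 2 * y) - 1) ∂(S.F k)
  let D : E → ℝ := fun k => ∫ y, (Real.exp (γ / 2 * y) - 1) ^ 2 ∂(S.F k)
  have hsq : ∀ y : ℝ, (Real.exp (γ / 2 * y) - 1) ^ 2
      = (Real.exp (γ * y) - 1) - 2 * (Real.exp (γ / 2 * y) - 1) := by
    intro y
    have : Real.exp (γ * y) = Real.exp (γ / 2 * y) ^ 2 := by
      rw [← Real.exp_nat_mul]; congr 1; push_cast; ring
    rw [this]; ring
  have hI : ∀ k, Integrable (fun y => Real.exp (γ * y) - 1) (S.F k) :=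
    fun k => (hint k).sub (integrable_const _)
  have hI2 : ∀ k, Integrable (fun y => Real.exp (γ / 2 * y) - 1) (S.F k) :=
    fun k => (hint2 k).sub (integrable_const _)
  have hDint : ∀ k, Integrable (fun y => (Real.exp (γ / 2 * y) - 1) ^ 2) (S.F k) := by
    intro k
    simp only [hsq]
    exact (hI k).sub ((hI2 k).const_mul 2)
  have hD : ∀ k, D k = (∫ y, (Real.exp (γ * y) - 1) ∂(S.F k)) - 2 * J k := by
    intro k
    simp only [D, J, hsq]
    rw [integral_sub (hI k) ((hI2 k).const_mul 2), integral_const_mul]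
  have hD0 : ∀ k, 0 ≤ D k := fun k => integral_nonneg fun y => sq_nonneg _
  have hJ : ∀ k, -1 ≤ J k := by
    intro k
    have : ∫ _, (-1 : ℝ) ∂(S.F k) ≤ J k := by
      refine integral_mono (integrable_const _) (hI2 k) fun y => ?_
      have := Real.exp_pos (γ / 2 * y)
      simp only
      linarith
    simpa using this
  obtain ⟨k₀, hk₀⟩ := S.exists_integral_sq_pos hm (half_pos hγ) hDint
  let w : E → ℝ := fun k => √(h k)
  have hw : ∀ k, 0 < w k := fun k => Real.sqrt_pos.mpr (hh_pos k)
  have hww : ∀ k, w k * w k = h k := fun k => Real.mul_self_sqrt (hh_pos k).le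
  have hmain : ∀ k, 2 * w k * (S.lam k * J k * w k + ∑ r, S.Q k r * w r)
      ≤ -(h k * S.lam k * D k) := by
    intro k
    have h1 : ∑ r, S.Q k r * (2 * w k * w r) ≤ ∑ r, S.Q k r * (h k + h r) := by
      refine Finset.sum_le_sum fun r _ => ?_
      by_cases hkr : k = r
      · subst hkr
        exact le_of_eq (by rw [← hww k]; ring)
      · refine mul_le_mul_of_nonneg_left ?_ (S.Q_nonneg hkr)
        rw [← hww k, ← hww r]
        nlinarith [sq_nonneg (w k - w r)]
    have h2 : ∑ r, S.Q k r * (h k + h r) = ∑ r, S.Q k r * h r := by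
      simp only [mul_add, Finset.sum_add_distrib, ← Finset.sum_mul, S.Q_row_sum]
      ring
    have h3 : ∑ r, S.Q k r * (2 * w k * w r) = 2 * w k * ∑ r, S.Q k r * w r := by
      rw [Finset.mul_sum]
      exact Finset.sum_congr rfl fun r _ => by ring
    have h4 := hh k
    have h5 : 2 * w k * (S.lam k * J k * w k) = S.lam k * (2 * J k) * h k := by
      rw [← hww k]; ring
    rw [mul_add, h5, ← h3, hD k]
    linarith
  have hβ : 0 < S.rate := (add_pos (S.lam_pos k₀) (S.nu_pos k₀)).trans_le (S.lam_add_nu_le_rate k₀)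
  -- `1 + rate⁻¹ K(γ/2)` is a nonnegative matrix, irreducible together with `p`.
  let T : Matrix E E ℝ := Matrix.of fun k r =>
    S.rate⁻¹ * ((if k = r then S.rate + S.lam k * J k else 0) + S.Q k r)
  have hTv : ∀ (v : E → ℝ) k, (T *ᵥ v) k
      = v k + S.rate⁻¹ * (S.lam k * J k * v k + ∑ r, S.Q k r * v r) := by
    intro v k
    simp only [T, Matrix.mulVec, dotProduct, Matrix.of_apply, mul_assoc, add_mul, ite_mul, zero_mul,
      ← Finset.mul_sum, Finset.sum_add_distrib, Finset.sum_ite_eq, Finset.mem_univ, if_true]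
    field_simp
    ring
  have hTp : ∀ k r, S.rate⁻¹ * (S.nu k * S.p k r) ≤ T k r := by
    intro k r
    simp only [T, Matrix.of_apply, Q_apply]
    refine mul_le_mul_of_nonneg_left ?_ (inv_pos.mpr hβ).le
    split_ifs
    · have h1 := S.lam_add_nu_le_rate k
      have h2 := mul_le_mul_of_nonneg_left (hJ k) (S.lam_pos k).le
      linarith
    · simp
  have hTpos : ∀ k r, 0 < S.p k r → 0 < T k r := fun k r hkr =>
    (mul_pos (inv_pos.mpr hβ) (mul_pos (S.nu_pos k) hkr)).trans_le (hTp k r)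
  have hTnn : ∀ k r, 0 ≤ T k r := fun k r =>
    (mul_nonneg (inv_pos.mpr hβ).le
      (mul_nonneg (S.nu_pos k).le (S.p_irreducible.nonneg k r))).trans (hTp k r)
  have hreach : ∀ i, ∃ m : ℕ, 0 < (T ^ m) i k₀ := by
    intro i
    obtain ⟨m, -, hm⟩ := (Matrix.isIrreducible_iff_exists_pow_pos S.p_irreducible.nonneg).mp
      S.p_irreducible i k₀
    exact ⟨m, Matrix.pow_apply_pos_of_pos_imp S.p_irreducible.nonneg hTnn hTpos m i k₀ hm⟩
  obtain ⟨v, hv, hTv'⟩ := Matrix.exists_mulVec_lt hTnn hw (k₀ := k₀) (fun k => by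
      rw [hTv]
      have h1 : S.lam k * J k * w k + ∑ r, S.Q k r * w r ≤ 0 := by
        have h2 := mul_nonneg (mul_nonneg (hh_pos k).le (S.lam_pos k).le) (hD0 k)
        exact nonpos_of_mul_nonpos_right ((hmain k).trans (neg_nonpos.mpr h2))
          (mul_pos two_pos (hw k))
      linarith [mul_nonpos_of_nonneg_of_nonpos (inv_pos.mpr hβ).le h1]) (by
      rw [hTv]
      have h1 : S.lam k₀ * J k₀ * w k₀ + ∑ r, S.Q k₀ r * w r < 0 := by
        have h2 := mul_pos (mul_pos (hh_pos k₀) (S.lam_pos k₀)) hk₀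
        exact neg_of_mul_neg_right ((hmain k₀).trans_lt (neg_lt_zero.mpr h2))
          (mul_pos two_pos (hw k₀)).le
      linarith [mul_neg_of_pos_of_neg (inv_pos.mpr hβ) h1]) hreach
  refine ⟨v, hv, fun k => ?_⟩
  have h1 := hTv' k
  rw [hTv] at h1
  exact neg_of_mul_neg_right (by linarith) (inv_pos.mpr hβ).le

/-- The function that is exponential below `u` with weights `a k`, and constant `b` above. -/
noncomputable def expBelow (a : E → ℝ) (θ b u : ℝ) (k : E) (y : ℝ) : ℝ :=
  if y ≤ u then a k * Real.exp (θ * (y - u)) else b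

omit [DecidableEq E] [Fintype E] in
lemma measurable_expBelow (a : E → ℝ) (θ b u : ℝ) (k : E) : Measurable (expBelow a θ b u k) :=
  Measurable.ite measurableSet_Iic (by fun_prop) measurable_const

omit [DecidableEq E] in
lemma abs_expBelow_le {a : E → ℝ} (ha : ∀ k, 0 ≤ a k) {θ b : ℝ} (hθ : 0 ≤ θ) (hb : 0 ≤ b)
    (u : ℝ) (k : E) (y : ℝ) : |expBelow a θ b u k y| ≤ ∑ r, a r + b := by
  unfold expBelow
  have h1 : a k ≤ ∑ r, a r := Finset.single_le_sum (fun r _ => ha r) (Finset.mem_univ k)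
  have h2 : 0 ≤ ∑ r, a r := Finset.sum_nonneg fun r _ => ha r
  split_ifs with h
  · rw [abs_of_nonneg (mul_nonneg (ha k) (Real.exp_pos _).le)]
    have h3 : Real.exp (θ * (y - u)) ≤ 1 :=
      Real.exp_le_one_iff.mpr (mul_nonpos_of_nonneg_of_nonpos hθ (by linarith))
    linarith [mul_le_of_le_one_right (ha k) h3]
  · rw [abs_of_nonneg hb]
    linarith

/-- The generator applied to `expBelow`: the exponential contributes as on the whole line, and the
jumps across the level `u` are corrected. -/
lemma gen_expBelow (a : E → ℝ) {θ : ℝ} (b u : ℝ) (k : E)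
    (hint : Integrable (fun y => Real.exp (θ * y)) (S.F k)) {y : ℝ} (hy : y ≤ u) :
    S.gen (expBelow a θ b u) k y
      = Real.exp (θ * (y - u)) * (S.lam k * (∫ z, (Real.exp (θ * z) - 1) ∂(S.F k)) * a k
          + ∑ r, S.Q k r * a r)
        + S.lam k * (b * (S.F k).real (Ioi (u - y))
          - a k * ∫ z in Ioi (u - y), Real.exp (θ * (z - (u - y))) ∂(S.F k)) := by
  have hpt : ∀ z, expBelow a θ b u k (y + z) - expBelow a θ b u k y
      = a k * Real.exp (θ * (y - u)) * (Real.exp (θ * z) - 1)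
        + (Ioi (u - y)).indicator (fun z => b - a k * Real.exp (θ * (z - (u - y)))) z := by
    intro z
    have h1 : Real.exp (θ * (y + z - u)) = Real.exp (θ * (y - u)) * Real.exp (θ * z) := by
      rw [← Real.exp_add]; ring_nf
    have h2 : Real.exp (θ * (z - (u - y))) = Real.exp (θ * (y - u)) * Real.exp (θ * z) := by
      rw [← Real.exp_add]; ring_nf
    unfold expBelow
    rw [if_pos hy]
    by_cases hz : y + z ≤ u
    · rw [if_pos hz, indicator_of_notMem (by simp; linarith), h1]
      ring
    · rw [if_neg hz, indicator_of_mem (by simp; linarith), h2]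
      ring
  have hint' : Integrable (fun z => Real.exp (θ * (z - (u - y)))) (S.F k) := by
    have : ∀ z, Real.exp (θ * (z - (u - y))) = Real.exp (θ * (y - u)) * Real.exp (θ * z) := by
      intro z
      rw [← Real.exp_add]; ring_nf
    simp only [this]
    exact hint.const_mul _
  have hQ : ∑ r, S.Q k r * expBelow a θ b u r y
      = Real.exp (θ * (y - u)) * ∑ r, S.Q k r * a r := by
    rw [Finset.mul_sum]
    refine Finset.sum_congr rfl fun r _ => ?_
    unfold expBelow
    rw [if_pos hy]
    ring
  have hi1 : Integrable (fun z => a k * Real.exp (θ * (y - u)) * (Real.exp (θ * z) - 1)) (S.F k) :=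
    (hint.sub (integrable_const _)).const_mul _
  have hi2 : Integrable (fun z => b - a k * Real.exp (θ * (z - (u - y)))) (S.F k) :=
    (integrable_const _).sub (hint'.const_mul _)
  unfold gen
  simp only [hpt]
  rw [hQ, integral_add hi1 (hi2.indicator measurableSet_Ioi),
    integral_const_mul, integral_indicator measurableSet_Ioi,
    integral_sub (integrable_const _) (hint'.const_mul _).integrableOn, integral_const_mul,
    setIntegral_const, smul_eq_mul]
  ring

end ChainParams

/-! ### The Lundberg ratios -/

namespace ChainParams

variable {E : Type*} [Fintype E] (S : ChainParams E)

/-- The overshoot integral dominates the tail, as `exp (γ (y - x)) ≥ 1` for `y > x`. -/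
lemma tail_le_integral (k : E) {γ : ℝ} (hγ : 0 < γ)
    (hint : Integrable (fun y => Real.exp (γ * y)) (S.F k)) (x : ℝ) :
    (S.F k).real (Ioi x) ≤ ∫ y in Ioi x, Real.exp (γ * (y - x)) ∂(S.F k) := by
  have hint' : Integrable (fun y => Real.exp (γ * (y - x))) (S.F k) := by
    have : ∀ y, Real.exp (γ * (y - x)) = Real.exp (-(γ * x)) * Real.exp (γ * y) := by
      intro y
      rw [← Real.exp_add]; ring_nf
    simp only [this]
    exact hint.const_mul _
  have h := setIntegral_mono_on (integrable_const (1 : ℝ)).integrableOn hint'.integrableOn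
    (measurableSet_Ioi (a := x)) fun y (hy : x < y) =>
      Real.one_le_exp (mul_nonneg hγ.le (sub_nonneg.mpr hy.le))
  simpa using h

lemma lundbergRatios_nonneg (γ : ℝ) {h : E → ℝ} (hh : ∀ k, 0 < h k) {v : ℝ}
    (hv : v ∈ S.lundbergRatios γ h) : 0 ≤ v := by
  obtain ⟨j, x, -, -, rfl⟩ := hv
  have := hh j
  have := integral_nonneg (μ := (S.F j).restrict (Ioi x))
    (f := fun y => Real.exp (γ * (y - x))) fun y => (Real.exp_pos _).le
  positivity

lemma Cplus_nonneg (γ : ℝ) {h : E → ℝ} (hh : ∀ k, 0 < h k) : 0 ≤ S.Cplus γ h :=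
  Real.sSup_nonneg fun _ hv => S.lundbergRatios_nonneg γ hh hv

lemma Cminus_nonneg (γ : ℝ) {h : E → ℝ} (hh : ∀ k, 0 < h k) : 0 ≤ S.Cminus γ h :=
  Real.sInf_nonneg fun _ hv => S.lundbergRatios_nonneg γ hh hv

lemma bddAbove_lundbergRatios {γ : ℝ} (hγ : 0 < γ)
    (hint : ∀ k, Integrable (fun y => Real.exp (γ * y)) (S.F k)) {h : E → ℝ}
    (hh : ∀ k, 0 < h k) : BddAbove (S.lundbergRatios γ h) := by
  refine ⟨∑ k, 1 / h k, ?_⟩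
  rintro v ⟨j, x, -, -, rfl⟩
  refine (mul_le_of_le_one_right (one_div_pos.mpr (hh j)).le ?_).trans
    (Finset.single_le_sum (f := fun k => 1 / h k) (fun k _ => (one_div_pos.mpr (hh k)).le)
      (Finset.mem_univ j))
  have h1 := S.tail_le_integral j hγ (hint j) x
  exact div_le_one_of_le₀ h1 (measureReal_nonneg.trans h1)

/-- The defining inequality of `Cplus`. It also holds where the tail vanishes, both sides being
zero. -/
lemma tail_le_Cplus {γ : ℝ} (hγ : 0 < γ)
    (hint : ∀ k, Integrable (fun y => Real.exp (γ * y)) (S.F k)) {h : E → ℝ}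
    (hh : ∀ k, 0 < h k) (k : E) {x : ℝ} (hx : 0 ≤ x) :
    (S.F k).real (Ioi x)
      ≤ S.Cplus γ h * h k * ∫ y in Ioi x, Real.exp (γ * (y - x)) ∂(S.F k) := by
  have h1 := S.tail_le_integral k hγ (hint k) x
  rcases (measureReal_nonneg (μ := S.F k) (s := Ioi x)).eq_or_lt with h0 | h0
  · rw [← h0] at h1 ⊢
    exact mul_nonneg (mul_nonneg (S.Cplus_nonneg γ hh) (hh k).le) h1
  · have h2 := le_csSup (S.bddAbove_lundbergRatios hγ hint hh) ⟨k, x, hx, h0, rfl⟩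
    rw [one_div, inv_mul_le_iff₀ (hh k), div_le_iff₀ (h0.trans_le h1)] at h2
    rw [mul_comm (S.Cplus γ h)]
    exact h2

lemma Cminus_le_tail {γ : ℝ} (hγ : 0 < γ)
    (hint : ∀ k, Integrable (fun y => Real.exp (γ * y)) (S.F k)) {h : E → ℝ}
    (hh : ∀ k, 0 < h k) (k : E) {x : ℝ} (hx : 0 ≤ x) :
    S.Cminus γ h * h k * ∫ y in Ioi x, Real.exp (γ * (y - x)) ∂(S.F k)
      ≤ (S.F k).real (Ioi x) := by
  have h1 := S.tail_le_integral k hγ (hint k) x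
  rcases (measureReal_nonneg (μ := S.F k) (s := Ioi x)).eq_or_lt with h0 | h0
  · have h2 : (S.F k).restrict (Ioi x) = 0 := by
      rw [Measure.restrict_eq_zero, ← ofReal_measureReal (μ := S.F k), ← h0, ENNReal.ofReal_zero]
    rw [h2]
    simp
  · have h2 := csInf_le (⟨0, fun _ hv => S.lundbergRatios_nonneg γ hh hv⟩ :
      BddBelow (S.lundbergRatios γ h)) ⟨k, x, hx, h0, rfl⟩
    rw [one_div, le_inv_mul_iff₀ (hh k), le_div_iff₀ (h0.trans_le h1)] at h2
    rw [mul_comm (S.Cminus γ h)]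
    exact h2

end ChainParams

/-! ### Refining the grid -/

/-- The event of no ruin on the dyadic grid of mesh `2⁻ᵐ` in `[0, m]`. -/
def noRuinDyadic {Ω : Type*} (ξ : ℝ≥0 → Ω → ℝ) (u : ℝ) (m : ℕ) : Set Ω :=
  noRuin ξ u ((1 / 2) ^ m) (m * 2 ^ m)

lemma antitone_noRuinDyadic {Ω : Type*} (ξ : ℝ≥0 → Ω → ℝ) (u : ℝ) :
    Antitone (noRuinDyadic ξ u) := by
  refine antitone_nat_of_succ_le fun m ω hω j hj => ?_
  have h := hω (2 * j) (by rw [pow_succ]; nlinarith [Nat.zero_le (2 ^ m)])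
  have h2 : ((2 * j : ℕ) : ℝ≥0) * (1 / 2) ^ (m + 1) = j * (1 / 2) ^ m := by
    push_cast
    rw [pow_succ]
    field_simp
  rwa [h2] at h

/-- A right-continuous path that exceeds `u` does so at some dyadic time. -/
lemma exists_notMem_noRuinDyadic {Ω : Type*} {ξ : ℝ≥0 → Ω → ℝ} {u : ℝ} {ω : Ω}
    (hω : ∀ t : ℝ≥0, ContinuousWithinAt (fun s => ξ s ω) (Ioi t) t) {t : ℝ≥0} (ht : u < ξ t ω) :
    ∃ m, ω ∉ noRuinDyadic ξ u m := by
  have h1 : ∀ᶠ s in nhdsWithin t (Ioi t), u < ξ s ω := (hω t).eventually (lt_mem_nhds ht)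
  obtain ⟨b, hb, hb'⟩ := (mem_nhdsGT_iff_exists_Ioo_subset).mp h1
  have hb : t < b := hb
  obtain ⟨m, hm⟩ := exists_pow_lt_of_lt_one (tsub_pos_of_lt hb)
    (by rw [← NNReal.coe_lt_coe]; norm_num : (1 / 2 : ℝ≥0) < 1)
  -- The first grid point after `t`, on a grid fine enough and long enough to reach it.
  obtain ⟨M, hM⟩ := exists_nat_gt (t + 1)
  let l := max m M
  have hl : (1 / 2 : ℝ≥0) ^ l < b - t :=
    (pow_le_pow_of_le_one zero_le (by rw [← NNReal.coe_le_coe]; norm_num)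
      (le_max_left m M)).trans_lt hm
  refine ⟨l, fun H => ?_⟩
  let j := ⌊t * 2 ^ l⌋₊ + 1
  have hj1 : t * 2 ^ l < j := by
    have := Nat.lt_floor_add_one (t * 2 ^ l)
    simpa [j] using this
  have hj2 : (j : ℝ≥0) ≤ t * 2 ^ l + 1 := by
    have := Nat.floor_le (zero_le : 0 ≤ t * 2 ^ l)
    simp only [j]
    push_cast
    gcongr
  have hpow : (2 : ℝ≥0) ^ l * (1 / 2) ^ l = 1 := by
    rw [← mul_pow]; norm_num
  have hp : 0 < (1 / 2 : ℝ≥0) ^ l := by positivity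
  have hlt : t < j * (1 / 2) ^ l := by
    calc t = t * 2 ^ l * (1 / 2) ^ l := by rw [mul_assoc, hpow, mul_one]
      _ < j * (1 / 2) ^ l := by gcongr
  have hlt' : j * (1 / 2) ^ l < b := by
    calc (j : ℝ≥0) * (1 / 2) ^ l ≤ (t * 2 ^ l + 1) * (1 / 2) ^ l := by gcongr
      _ = t + (1 / 2) ^ l := by rw [add_mul, mul_assoc, hpow, mul_one, one_mul]
      _ < b := by rw [add_comm]; exact lt_tsub_iff_right.mp hl
  have hjl : j ≤ l * 2 ^ l := by
    have h2 : (j : ℝ≥0) ≤ l * 2 ^ l := by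
      calc (j : ℝ≥0) ≤ t * 2 ^ l + 1 := hj2
        _ ≤ t * 2 ^ l + 1 * 2 ^ l := by
            gcongr
            rw [one_mul]
            exact one_le_pow₀ (by rw [← NNReal.coe_le_coe]; norm_num)
        _ = (t + 1) * 2 ^ l := by ring
        _ ≤ l * 2 ^ l := by
            gcongr
            exact hM.le.trans (by exact_mod_cast le_max_right m M)
    exact_mod_cast h2
  exact absurd (H j hjl) (not_le.mpr (hb' ⟨hlt, hlt'⟩))

lemma tendsto_dyadic_error (c : ℝ) :
    Filter.Tendsto (fun m : ℕ => ((m * 2 ^ m : ℕ) : ℝ) * (c * ((1 / 2 : ℝ) ^ m) ^ 2))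
      Filter.atTop (nhds 0) := by
  have h := (tendsto_self_mul_const_pow_of_lt_one (r := (1 / 2 : ℝ)) (by norm_num)
    (by norm_num)).const_mul c
  rw [mul_zero] at h
  refine h.congr fun m => ?_
  have h1 : (2 : ℝ) ^ m * (1 / 2) ^ m = 1 := by rw [← mul_pow]; norm_num
  push_cast
  calc c * (m * (1 / 2 : ℝ) ^ m) = c * (m * (1 / 2 : ℝ) ^ m) * (2 ^ m * (1 / 2) ^ m) := by
        rw [h1, mul_one]
    _ = _ := by ring

namespace IsMarkovAdditive

variable {E Ω : Type*} [Fintype E] [DecidableEq E] {mΩ : MeasurableSpace Ω} {S : ChainParams E}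
  {P : E → Measure Ω} {ℱ : Filtration ℝ≥0 mΩ} {x : ℝ≥0 → Ω → E} {ξ : ℝ≥0 → Ω → ℝ}

/-- The ruin probability is the limit of the ruin probabilities on dyadic grids. -/
lemma tendsto_ruinProb (hZ : IsMarkovAdditive S.Psi P ℱ x ξ) (i : E) (u : ℝ) :
    Filter.Tendsto (fun m => (P i).real (noRuinDyadic ξ u m)ᶜ) Filter.atTop
      (nhds (ruinProb P ξ i u)) := by
  have := hZ.prob i
  have h1 : {ω | (u : EReal) < absMax ξ ω} =ᵐ[P i] ⋃ m, (noRuinDyadic ξ u m)ᶜ := by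
    filter_upwards [hZ.right_cont i] with ω hω
    refine propext ⟨fun h => ?_, fun h => ?_⟩
    · obtain ⟨t, ht⟩ := lt_iSup_iff.mp (show (u : EReal) < ⨆ t : ℝ≥0, (ξ t ω : EReal) from h)
      obtain ⟨m, hm⟩ := exists_notMem_noRuinDyadic hω (EReal.coe_lt_coe_iff.mp ht)
      exact mem_iUnion.mpr ⟨m, hm⟩
    · obtain ⟨m, hm⟩ := mem_iUnion.mp h
      have hm' : ¬ ∀ j ≤ m * 2 ^ m, ξ (j * (1 / 2) ^ m) ω ≤ u := hm
      push Not at hm'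
      obtain ⟨j, -, hj⟩ := hm'
      exact (EReal.coe_lt_coe_iff.mpr hj).trans_le
        (le_iSup (fun t : ℝ≥0 => (ξ t ω : EReal)) (j * (1 / 2) ^ m))
  have h2 : Monotone fun m => (noRuinDyadic ξ u m)ᶜ :=
    fun a b hab => compl_subset_compl.mpr (antitone_noRuinDyadic ξ u hab)
  have h3 := tendsto_measure_iUnion_atTop (μ := P i) h2
  unfold ruinProb
  rw [measureReal_congr h1]
  exact (ENNReal.tendsto_toReal (measure_ne_top _ _)).comp h3

/-! ### Bounds from super- and subharmonic functions -/

/-- If the exponential function with weights `a`, extended by `1` above `u`, is superharmonic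
below `u`, it bounds the ruin probability. -/
lemma ruinProb_le (hZ : IsMarkovAdditive S.Psi P ℱ x ξ) {a : E → ℝ} (ha : ∀ k, 0 ≤ a k)
    {γ : ℝ} (hγ : 0 ≤ γ) {u : ℝ} (hu : 0 ≤ u)
    (hgen : ∀ k y, y ≤ u → S.gen (ChainParams.expBelow a γ 1 u) k y ≤ 0) (i : E) :
    ruinProb P ξ i u ≤ a i * Real.exp (-γ * u) := by
  have hM : 0 < ∑ r, a r + 1 := by linarith [Finset.sum_nonneg fun r (_ : r ∈ Finset.univ) => ha r]
  set M := ∑ r, a r + 1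
  have hf0 : ChainParams.expBelow a γ 1 u i 0 = a i * Real.exp (-γ * u) := by
    simp [ChainParams.expBelow, hu]
  refine le_of_tendsto_of_tendsto' (hZ.tendsto_ruinProb i u)
    ((tendsto_dyadic_error (M * (3 * S.rate ^ 2))).const_add (a i * Real.exp (-γ * u))
      |>.trans (by rw [add_zero])) fun m => ?_
  have h1 := hZ.stoppedValue_le (ChainParams.measurable_expBelow a γ 1 u) hM
    (ChainParams.abs_expBelow_le ha hγ zero_le_one u) hu
    (fun k y hy => if_neg (not_le.mpr hy)) hgen ((1 / 2) ^ m) i (m * 2 ^ m)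
  rw [hf0] at h1
  have h2 : (P i).real (noRuinDyadic ξ u m)ᶜ
      ≤ stoppedValue P x ξ (ChainParams.expBelow a γ 1 u) 1 u ((1 / 2) ^ m) i (m * 2 ^ m) := by
    unfold stoppedValue
    rw [one_mul]
    refine le_add_of_nonneg_left (integral_nonneg fun ω => ?_)
    simp only [ChainParams.expBelow, Pi.zero_apply]
    split_ifs
    · exact mul_nonneg (ha _) (Real.exp_pos _).le
    · exact zero_le_one
  refine h2.trans (h1.trans (le_of_eq ?_))
  push_cast
  ring

/-- If the exponential function with weights `a`, extended by `1` above `u`, is subharmonic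
below `u`, it is a lower bound of the ruin probability, provided that some exponential function
with a smaller exponent is contracted, so that `ξ` does not stay below `u` near `u`. -/
lemma le_ruinProb (hZ : IsMarkovAdditive S.Psi P ℱ x ξ) {a v : E → ℝ} (ha : ∀ k, 0 ≤ a k)
    (hv : ∀ k, 0 < v k) {γ θ ε : ℝ} (hθ : 0 ≤ θ) (hθγ : θ ≤ γ) (hε : 0 < ε) (hε1 : ε ≤ 1)
    {u : ℝ} (hu : 0 ≤ u)
    (hgen : ∀ k y, y ≤ u → 0 ≤ S.gen (ChainParams.expBelow a γ 1 u) k y)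
    (hdecay : ∀ k y, y ≤ u → S.gen (ChainParams.expBelow v θ 0 u) k y
      ≤ -(ε * ChainParams.expBelow v θ 0 u k y)) (i : E) :
    a i * Real.exp (-γ * u) ≤ ruinProb P ξ i u := by
  have := hZ.prob i
  have hM : 0 < ∑ r, a r + 1 := by linarith [Finset.sum_nonneg fun r (_ : r ∈ Finset.univ) => ha r]
  set M := ∑ r, a r + 1
  have hV : 0 < ∑ r, v r + 0 := by
    rw [add_zero]
    exact Finset.sum_pos (fun r _ => hv r) ⟨i, Finset.mem_univ i⟩
  set V := ∑ r, v r + 0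
  -- On survival the subharmonic function is dominated by the contracted one.
  let c := ∑ r, a r / v r
  have hc : 0 ≤ c := Finset.sum_nonneg fun r _ => div_nonneg (ha r) (hv r).le
  have hac : ∀ k, a k ≤ c * v k := fun k => (div_le_iff₀ (hv k)).mp
    (Finset.single_le_sum (f := fun r => a r / v r) (fun r _ => div_nonneg (ha r) (hv r).le)
      (Finset.mem_univ k))
  have hdom : ∀ k y, y ≤ u → ChainParams.expBelow a γ 1 u k y
      ≤ c * ChainParams.expBelow v θ 0 u k y := by
    intro k y hy
    unfold ChainParams.expBelow
    rw [if_pos hy, if_pos hy, ← mul_assoc]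
    refine mul_le_mul (hac k) (Real.exp_le_exp.mpr ?_) (Real.exp_pos _).le
      (mul_nonneg hc (hv k).le)
    exact mul_le_mul_of_nonpos_right hθγ (by linarith)
  have hf0 : ChainParams.expBelow a γ 1 u i 0 = a i * Real.exp (-γ * u) := by
    simp [ChainParams.expBelow, hu]
  have hmf := ChainParams.measurable_expBelow (E := E) a γ 1 u
  have hbf := ChainParams.abs_expBelow_le ha (hθ.trans hθγ) zero_le_one u
  have hmg := ChainParams.measurable_expBelow (E := E) v θ 0 u
  have hbg := ChainParams.abs_expBelow_le (fun k => (hv k).le) hθ le_rfl u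
  let err : ℕ → ℝ := fun m =>
    ((m * 2 ^ m : ℕ) : ℝ) * (M * (3 * S.rate ^ 2) * ((1 / 2 : ℝ) ^ m) ^ 2)
      + c * (V * Real.exp (-(ε * m)) + V * (3 * S.rate ^ 2 * (1 / 2) ^ m) / ε)
  have herr : Filter.Tendsto err Filter.atTop (nhds 0) := by
    have h1 : Filter.Tendsto (fun m : ℕ => Real.exp (-(ε * m))) Filter.atTop (nhds 0) :=
      Real.tendsto_exp_neg_atTop_nhds_zero.comp
        (tendsto_natCast_atTop_atTop.const_mul_atTop hε)
    have h2 : Filter.Tendsto (fun m : ℕ => (1 / 2 : ℝ) ^ m) Filter.atTop (nhds 0) :=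
      tendsto_pow_atTop_nhds_zero_of_lt_one (by norm_num) (by norm_num)
    have h3 := (tendsto_dyadic_error (M * (3 * S.rate ^ 2))).add
      (((h1.const_mul V).add
        (((h2.const_mul (3 * S.rate ^ 2)).const_mul V).div_const ε)).const_mul c)
    simpa only [mul_zero, zero_div, add_zero] using h3
  have hlim := (hZ.tendsto_ruinProb i u).add herr
  rw [add_zero] at hlim
  refine ge_of_tendsto' hlim fun m => ?_
  have hδ : (((m * 2 ^ m : ℕ) : ℝ)) * (((1 / 2 : ℝ≥0) ^ m : ℝ≥0) : ℝ) = m := by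
    push_cast
    rw [mul_assoc, ← mul_pow]
    norm_num
  have h1 := hZ.le_stoppedValue hmf hM hbf hu
    (fun k y hy => if_neg (not_le.mpr hy)) hgen ((1 / 2) ^ m) i (m * 2 ^ m)
  have h2 := hZ.stoppedValue_le_exp hmg hV hbg hu
    (fun k y hy => if_neg (not_le.mpr hy)) hε hdecay (δ := (1 / 2) ^ m) (by
      push_cast
      exact mul_le_one₀ hε1 (by positivity) (pow_le_one₀ (by norm_num) (by norm_num)))
      i (m * 2 ^ m)
  rw [hδ] at h2
  have h3 : stoppedValue P x ξ (ChainParams.expBelow a γ 1 u) 1 u ((1 / 2) ^ m) i (m * 2 ^ m)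
      ≤ c * stoppedValue P x ξ (ChainParams.expBelow v θ 0 u) 0 u ((1 / 2) ^ m) i (m * 2 ^ m)
        + (P i).real (noRuinDyadic ξ u m)ᶜ := by
    unfold stoppedValue
    rw [one_mul, zero_mul, add_zero, ← integral_const_mul]
    refine add_le_add (setIntegral_mono_on (hZ.integrable_state i _ hmf hbf).integrableOn
      ((hZ.integrable_state i _ hmg hbg).const_mul _).integrableOn
      (ℱ.le _ _ (hZ.measurableSet_noRuin u _ _)) fun ω hω => ?_) le_rfl
    exact hdom _ _ (hω _ le_rfl)
  have h4 := mul_le_mul_of_nonneg_left h2 hc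
  rw [hf0] at h1
  push_cast at h1 h4
  simp only [err]
  push_cast
  have h5 : (m : ℝ) * 2 ^ m * (M * (3 * (S.rate * (1 / 2) ^ m) ^ 2))
      = m * 2 ^ m * (M * (3 * S.rate ^ 2) * ((1 / 2) ^ m) ^ 2) := by ring
  linarith

end IsMarkovAdditive

theorem corollary2 {E : Type*} [Fintype E] [DecidableEq E] (S : ChainParams E)
    {Ω : Type*} [mΩ : MeasurableSpace Ω] (P : E → Measure Ω) (ℱ : Filtration ℝ≥0 mΩ)
    (x : ℝ≥0 → Ω → E) (ξ : ℝ≥0 → Ω → ℝ) (hZ : IsMarkovAdditive S.Psi P ℱ x ξ)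
    (pi : E → ℝ) (hpi : S.IsStationary pi) (hm : S.meanDrift pi < 0)
    (γ : ℝ) (hγ : 0 < γ)
    (hint : ∀ k, IntegrableOn (fun y => Real.exp (γ * y)) (Ioi 0) (S.F k))
    (hk : S.perronRoot γ = 0)
    (ν h : E → ℝ) (hν_pos : ∀ k, 0 < ν k) (hh_pos : ∀ k, 0 < h k)
    (hν : (fun k => (ν k : ℂ)) ᵥ* S.K γ = 0) (hh : S.K γ *ᵥ (fun k => (h k : ℂ)) = 0)
    (hνh : ν ⬝ᵥ h = 1) :
    ∀ (i : E) (u : ℝ), 0 ≤ u →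
      S.Cminus γ h * h i * Real.exp (-γ * u) ≤ ruinProb P ξ i u ∧
        ruinProb P ξ i u ≤ S.Cplus γ h * h i * Real.exp (-γ * u) := by
  intro i u hu
  have hI : ∀ k, Integrable (fun y => Real.exp (γ * y)) (S.F k) :=
    fun k => S.integrable_exp k hγ.le (hint k)
  have hI2 : ∀ k, Integrable (fun y => Real.exp (γ / 2 * y)) (S.F k) := by
    refine fun k => S.integrable_exp k (half_pos hγ).le ((hint k).mono' (by fun_prop) ?_)
    refine ae_restrict_of_forall_mem measurableSet_Ioi fun y (hy : 0 < y) => ?_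
    rw [Real.norm_eq_abs, abs_of_pos (Real.exp_pos _), Real.exp_le_exp]
    nlinarith
  have hreal := S.real_eigen hγ hint hh
  -- Weights proportional to `h` cancel the exponential part of the generator.
  have hgen : ∀ (C : ℝ) k y, y ≤ u → S.gen (ChainParams.expBelow (fun k => C * h k) γ 1 u) k y
      = S.lam k * ((S.F k).real (Ioi (u - y))
          - C * h k * ∫ z in Ioi (u - y), Real.exp (γ * (z - (u - y))) ∂(S.F k)) := by
    intro C k y hy
    have h1 : S.lam k * (∫ z, (Real.exp (γ * z) - 1) ∂(S.F k)) * (C * h k)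
        + ∑ r, S.Q k r * (C * h r) = 0 := by
      calc _ = C * (S.lam k * (∫ z, (Real.exp (γ * z) - 1) ∂(S.F k)) * h k
            + ∑ r, S.Q k r * h r) := by
              rw [mul_add, Finset.mul_sum]
              congr 1
              · ring
              · exact Finset.sum_congr rfl fun r _ => by ring
        _ = 0 := by rw [hreal k, mul_zero]
    rw [S.gen_expBelow _ 1 u k (hI k) hy, h1, mul_zero, zero_add, one_mul]
  constructor
  · obtain ⟨v, hv, hKv⟩ := S.exists_decay_vector hm hγ hI hI2 hh_pos hreal
    let d : E → ℝ := fun k =>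
      -(S.lam k * (∫ y, (Real.exp (γ / 2 * y) - 1) ∂(S.F k)) * v k + ∑ r, S.Q k r * v r) / v k
    have hd : ∀ k, 0 < d k := fun k => div_pos (neg_pos.mpr (hKv k)) (hv k)
    have hne : (Finset.univ : Finset E).Nonempty := ⟨i, Finset.mem_univ i⟩
    obtain ⟨k₀, -, hk₀⟩ := Finset.exists_min_image Finset.univ d hne
    refine hZ.le_ruinProb (a := fun k => S.Cminus γ h * h k)
      (fun k => mul_nonneg (S.Cminus_nonneg γ hh_pos) (hh_pos k).le) hv (half_pos hγ).le
      (half_le_self hγ.le) (ε := min (d k₀) 1) (lt_min (hd k₀) one_pos) (min_le_right _ _) hu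
      (fun k y hy => ?_) (fun k y hy => ?_) i
    · rw [hgen _ k y hy]
      exact mul_nonneg (S.lam_pos k).le (sub_nonneg.mpr
        (S.Cminus_le_tail hγ hI hh_pos k (sub_nonneg.mpr hy)))
    · rw [S.gen_expBelow v 0 u k (hI2 k) hy, ChainParams.expBelow, if_pos hy]
      have h1 : S.lam k * (∫ y, (Real.exp (γ / 2 * y) - 1) ∂(S.F k)) * v k
          + ∑ r, S.Q k r * v r ≤ -(min (d k₀) 1 * v k) := by
        have h2 := (min_le_left (d k₀) 1).trans (hk₀ k (Finset.mem_univ k))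
        have h3 := (le_div_iff₀ (hv k)).mp h2
        linarith
      have h4 : 0 ≤ S.lam k * (v k *
          ∫ z in Ioi (u - y), Real.exp (γ / 2 * (z - (u - y))) ∂(S.F k)) :=
        mul_nonneg (S.lam_pos k).le (mul_nonneg (hv k).le
          (integral_nonneg fun z => (Real.exp_pos _).le))
      have h5 := mul_le_mul_of_nonneg_left h1 (Real.exp_pos (γ / 2 * (y - u))).le
      linarith
  · refine hZ.ruinProb_le (a := fun k => S.Cplus γ h * h k)
      (fun k => mul_nonneg (S.Cplus_nonneg γ hh_pos) (hh_pos k).le) hγ.le hu (fun k y hy => ?_) i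
    rw [hgen _ k y hy]
    exact mul_nonpos_of_nonneg_of_nonpos (S.lam_pos k).le (sub_nonpos.mpr
      (S.tail_le_Cplus hγ hI hh_pos k (sub_nonneg.mpr hy)))
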